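/- Let $n\ge 1$ be an integer and index the entries of vectors in $\mathbb{C}^n$ by $\mathbb{Z}_n=\mathbb{Z}/n\mathbb{Z}$. For $k,\ell\in\mathbb{Z}_n$ let $(T_kh)_q=h_{k+q}$ and $(M_\ell h)_q=e^{2\pi i\ell q/n}h_q$ (indices modulo $n$), and put $\pi(\lambda)=M_\ell T_k$ for $\lambda=(k,\ell)$. For $g\in\mathbb{C}^n$ let $\Psi_g\in\mathbb{C}^{n\times n^2}$ be the Gabor synthesis matrix, whose columns are the vectors $\pi(\lambda)g$, $\lambda\in\mathbb{Z}_n\times\mathbb{Z}_n$. Let $g=g^R$ be the random window $g^R_q=n^{-1/2}\epsilon_q$, $q\in\mathbb{Z}_n$, where the $\epsilon_q$ are independent random variables, uniformly distributed on the torus $\{z\in\mathbb{C}:|z|=1\}$. We say that Basis Pursuit recovers $x\in\mathbb{C}^{n^2}$ from $y=\Psi_gx$ if $x$ is the unique minimizer of $\|z\|_1=\sum_\lambda|z_\lambda|$ among all $z\in\mathbb{C}^{n^2}$ with $\Psi_gz=y$. **Theorem.** (a) There is an absolute constant $C>0$ such that for all integers $n\ge1$ and $S\ge0$, every $\varepsilon\in(0,1)$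 and every fixed vector $x\in\mathbb{C}^{n^2}$ with at most $S$ non-zero entries the following holds: if $$S\le C\,\frac{n}{\log(n/\varepsilon)},$$ then with probability at least $1-\varepsilon$ Basis Pursuit recovers $x$ from $y=\Psi_gx$. (b) For the same range of $n,S,\varepsilon,x$, the conclusion also holds, that is, Basis Pursuit recovers $x$ from $y=\Psi_gx$ with probability at least $1-\varepsilon$, whenever $$n\ge\max\bigl\{273.5\,S\log(n^2/\varepsilon),\ 64.1\,S\bigl(\log(S^4/\varepsilon)+8.35\bigr)\bigr\}$$ (for $S=0$ the right-hand side is read as $0$). -/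

import Mathlib

open MeasureTheory ProbabilityTheory

noncomputable section

/-- The cyclic shift on `ℂ^n`: `(T_k h)_q = h_{k+q mod n}`. -/
def gaborShift {n : ℕ} (k : ZMod n) (h : ZMod n → ℂ) : ZMod n → ℂ :=
  fun q => h (k + q)

/-- The modulation on `ℂ^n`: `(M_ℓ h)_q = e^{2πiℓq/n} h_q`. Mathlib's `ZMod.stdAddChar` is the
additive character `j ↦ e^{2πij/n}` of `ℤ/n`. -/
def gaborModulation {n : ℕ} [NeZero n] (l : ZMod n) (h : ZMod n → ℂ) : ZMod n → ℂ :=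
  fun q => ZMod.stdAddChar (l * q) * h q

/-- The time-frequency shift `π(λ) = M_ℓ T_k` for `λ = (k, ℓ)`. -/
def timeFreqShift {n : ℕ} [NeZero n] (lam : ZMod n × ZMod n) (h : ZMod n → ℂ) : ZMod n → ℂ :=
  gaborModulation lam.2 (gaborShift lam.1 h)

/-- The Gabor synthesis matrix `Ψ_g ∈ ℂ^{n × n²}`, whose column of index `λ` is `π(λ) g`. -/
def gaborMatrix {n : ℕ} [NeZero n] (g : ZMod n → ℂ) :
    Matrix (ZMod n) (ZMod n × ZMod n) ℂ :=
  Matrix.of fun q lam => timeFreqShift lam g q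

/-- `x` is `S`-sparse: it has at most `S` non-zero entries. -/
def IsSparse {ι : Type*} (S : ℕ) (x : ι → ℂ) : Prop :=
  {i | x i ≠ 0}.ncard ≤ S

/-- The `ℓ¹`-norm of a finite complex vector. -/
def l1Norm {ι : Type*} [Fintype ι] (x : ι → ℂ) : ℝ :=
  ∑ i, ‖x i‖

/-- Basis Pursuit recovers `x` from `y = A x`: the vector `x` is the unique solution of
`min ‖z‖₁` subject to `A z = y`. -/
def BasisPursuitRecovers {κ ι : Type*} [Fintype ι] (A : Matrix κ ι ℂ) (x : ι → ℂ) : Prop :=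
  ∀ z : ι → ℂ, A.mulVec z = A.mulVec x → z ≠ x → l1Norm x < l1Norm z

/-- The uniform distribution on the torus `{z ∈ ℂ : |z| = 1}`: the law of `e^{2πit}` for `t`
uniform on `(0, 1]`. -/
def torusUniform : Measure ℂ :=
  (volume.restrict (Set.Ioc (0 : ℝ) 1)).map
    fun t : ℝ => Complex.exp (2 * Real.pi * t * Complex.I)

/-- `e` is a Steinhaus sequence: independent random variables, each of them uniformly distributed
on the torus. -/
def IsSteinhausSequence {Ω ι : Type*} [MeasurableSpace Ω] (P : Measure Ω) (e : ι → Ω → ℂ) :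
    Prop :=
  (∀ q, HasLaw (e q) torusUniform P) ∧ iIndepFun e P

/-- The normalized window `g_q = n^{-1/2} ε_q` at the outcome `ω`. -/
def randomWindow {n : ℕ} {Ω : Type*} (e : ZMod n → Ω → ℂ) (ω : Ω) : ZMod n → ℂ :=
  fun q => ((1 / Real.sqrt (n : ℝ) : ℝ) : ℂ) * e q ω

end

/-!
Write `Λ` for the support of `x`, `s` for its size, and `H` for the off-diagonal part of the Gram
matrix of the columns of `Ψ_g`. Almost surely the columns have norm one, and `x` is recovered as
soon as there is a dual certificate: a vector in the row space of `Ψ_g` that equals the sign vector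
`σ` of `x` on `Λ` and has entries of modulus less than one elsewhere
(`basisPursuitRecovers_of_certificate`). The candidate is `(1 + H) p` with `p` supported on `Λ` and
`p = (1 + H_Λ)⁻¹ σ`. Expanding the inverse into a Neumann series, its entry at `ρ ∉ Λ` is an
alternating sum of the iterates `T_m(ρ) = (H H_Λ^(m-1) σ)(ρ)`, `m ≥ 1`, up to a geometrically small
remainder, provided that `‖H_Λ‖ < 1`; and `‖H_Λ‖` is controlled by the Frobenius norm of a power of
`H_Λ`, the entries of which are iterates as well (`basisPursuitRecovers_of_iterate`). Everything
thus follows from a bound for the moments of the iterates: `E |T_m(ρ)|^(2K) ≤ κ^N` for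
`N = 2Km` up to a multiple of `n / s` (`integral_norm_iterate_pow_le`), where a logarithmic number
`N` of factors is enough for Markov's inequality and a union bound over `m` and `ρ`.

For the moment bound, `|T_m(ρ)|^(2K)` is expanded into a sum over `N`-tuples of points of `Λ`, the
expectation of each term being `n^(-N)` times a sum over placements `q ∈ (ℤ/n)^N`. Such a placement
is read as a directed multigraph on `ℤ/n` with one edge for each of the `N` entries of `H`; its
Steinhaus monomial has mean one or zero according to whether in-degrees equal out-degrees
(`steinhaus_integral_prod`). A balanced graph splits into components, each with an Eulerian circuit,
so that `k` given edges form a component through a given vertex in few ways, at most `(k - 1)!` for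
each choice of the edge at that vertex (`card_component_le`). The components are vertex disjoint,
and a cluster expansion removes this constraint (`exists_cluster_expansion`): the sum over
placements is bounded by a sum over partitions of the edges, in which a block of `k` edges has weight
`n (k - 1)!` up to a factor `3^k / 2`. Since all sums are covariant under translations of `ℤ/n`
and carry characters as weights, a block contributes only if the increments of the path in
`ℤ/n × ℤ/n` along its edges add up to zero (`exists_zeroSum_expansion`). Each block therefore
removes one of the `N` free points of `Λ` (`card_zeroSum_le`), which turns the block weight into
`(k - 1)! (s / n)^(k-1)` times the geometric factor, and the resulting sum over partitions is
bounded recursively (`blockSum_le_pow`).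

The sample size condition `n ≥ 273.5 s log (n² / ε)` alone is sufficient for this argument; it also
covers the asymptotic statement with the constant `1 / 547`.
-/

namespace GaborRecovery

/-! ### Eulerian circuits of balanced directed multigraphs -/

/-- A finite directed multigraph with edges `ι`, the edge `i` going from `a i` to `b i`, is balanced
on the edge set `C` if every vertex is as often a source as it is a target of an edge in `C`. -/
def Balanced {ι G : Type*} (a b : ι → G) (C : Finset ι) : Prop :=
  C.val.map a = C.val.map b

/-- `Walk a b u l w`: the edges in the list `l` can be traversed one after the other, starting at
the vertex `u` and ending at the vertex `w`. -/
def Walk {ι G : Type*} (a b : ι → G) : G → List ι → G → Prop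
  | u, [], w => u = w
  | u, x :: l, w => a x = u ∧ Walk a b (b x) l w

section Euler

variable {ι G : Type*} {a b : ι → G}

lemma walk_append {u w : G} {l l' : List ι} :
    Walk a b u (l ++ l') w ↔ ∃ z, Walk a b u l z ∧ Walk a b z l' w := by
  induction l generalizing u with
  | nil => simp [Walk]
  | cons x l ih => simp [Walk, ih, and_assoc]

lemma Walk.multiset_eq {u w : G} {l : List ι} (h : Walk a b u l w) :
    u ::ₘ (l : Multiset ι).map b = w ::ₘ (l : Multiset ι).map a := by
  induction l generalizing u with
  | nil =>
    simp only [Walk] at h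
    simp [h]
  | cons x l ih =>
    obtain ⟨rfl, h⟩ := h
    rw [← Multiset.cons_coe, Multiset.map_cons, Multiset.map_cons, ih h, Multiset.cons_swap]

lemma Walk.multiset_eq_of_closed {u : G} {l : List ι} (h : Walk a b u l u) :
    (l : Multiset ι).map b = (l : Multiset ι).map a :=
  (Multiset.cons_inj_right u).1 h.multiset_eq

lemma val_eq_coe_add_sdiff [DecidableEq ι] {C : Finset ι} {l : List ι} (hn : l.Nodup)
    (hl : ∀ x ∈ l, x ∈ C) : C.val = (l : Multiset ι) + (C \ l.toFinset).val := by
  have h : l.toFinset ⊆ C := fun x hx => hl x (List.mem_toFinset.1 hx)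
  have h1 : l.toFinset.val = (l : Multiset ι) := by
    rw [List.toFinset_val, hn.dedup]
  rw [Finset.sdiff_val, h1, add_comm, Multiset.sub_add_cancel]
  rw [← h1]
  exact Finset.val_le_iff.2 h

lemma Walk.length_le [DecidableEq ι] {C : Finset ι} {l : List ι} (hn : l.Nodup)
    (hl : ∀ x ∈ l, x ∈ C) : l.length ≤ C.card := by
  rw [← List.toFinset_card_of_nodup hn]
  exact Finset.card_le_card fun x hx => hl x (List.mem_toFinset.1 hx)

lemma Balanced.exists_unused [DecidableEq ι] [DecidableEq G] {C : Finset ι}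
    (hC : Balanced a b C) {u w : G}
    {l : List ι} (hn : l.Nodup) (hl : ∀ x ∈ l, x ∈ C) (hw : Walk a b u l w) (huw : w ≠ u) :
    ∃ e ∈ C, e ∉ l ∧ a e = w := by
  by_contra! hcon
  have h1 := congrArg (Multiset.count w) hw.multiset_eq
  rw [Multiset.count_cons_of_ne huw, Multiset.count_cons_self] at h1
  have h2 := congrArg (Multiset.count w) hC
  rw [val_eq_coe_add_sdiff hn hl, Multiset.map_add, Multiset.map_add, Multiset.count_add,
    Multiset.count_add] at h2
  have h3 : Multiset.count w ((C \ l.toFinset).val.map a) = 0 := by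
    rw [Multiset.count_eq_zero]
    intro hmem
    obtain ⟨e, he, hew⟩ := Multiset.mem_map.1 hmem
    have he' : e ∈ C \ l.toFinset := he
    rw [Finset.mem_sdiff, List.mem_toFinset] at he'
    exact hcon e he'.1 he'.2 hew
  omega

/-- A trail starting with `i` extends to a closed one; the induction runs over the number of unused
edges. -/
lemma Balanced.exists_closed_aux [DecidableEq ι] [DecidableEq G] {C : Finset ι}
    (hC : Balanced a b C) (i : ι) (k : ℕ) :
    ∀ (l : List ι) (w : G), (i :: l).Nodup → (∀ x ∈ i :: l, x ∈ C) →
      Walk a b (a i) (i :: l) w → C.card ≤ l.length + k →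
      ∃ l', (i :: l').Nodup ∧ (∀ x ∈ i :: l', x ∈ C) ∧ Walk a b (a i) (i :: l') (a i) := by
  induction k with
  | zero =>
    intro l w hn hl hw hk
    have := Walk.length_le hn hl
    simp at this
    omega
  | succ k ih =>
    intro l w hn hl hw hk
    by_cases h : w = a i
    · subst h; exact ⟨l, hn, hl, hw⟩
    · obtain ⟨e, he, hel, hea⟩ := hC.exists_unused hn hl hw h
      refine ih (l ++ [e]) (b e) ?_ ?_ ?_ ?_
      · rw [← List.cons_append, List.nodup_append]
        refine ⟨hn, by simp, ?_⟩
        intro x hx y hy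
        rw [List.mem_singleton] at hy
        subst hy
        rintro rfl
        exact hel hx
      · intro x hx
        rw [← List.cons_append, List.mem_append, List.mem_singleton] at hx
        rcases hx with hx | rfl
        · exact hl x hx
        · exact he
      · rw [← List.cons_append, walk_append]
        exact ⟨w, hw, hea, rfl⟩
      · simp only [List.length_append, List.length_singleton]
        omega

/-- In a balanced graph every edge is the first edge of a closed trail. -/
lemma Balanced.exists_closed [DecidableEq ι] [DecidableEq G] {C : Finset ι}
    (hC : Balanced a b C) {i : ι} (hi : i ∈ C) :
    ∃ l, (i :: l).Nodup ∧ (∀ x ∈ i :: l, x ∈ C) ∧ Walk a b (a i) (i :: l) (a i) :=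
  hC.exists_closed_aux i C.card [] (b i) (by simp) (by simpa using hi) (by simp [Walk]) (by simp)

/-- The vertices that can be reached from `v` along edges in `C`. -/
def Reach (a b : ι → G) (C : Finset ι) (v g : G) : Prop :=
  Relation.ReflTransGen (fun x y => ∃ i ∈ C, a i = x ∧ b i = y) v g

lemma Balanced.sdiff_of_closed [DecidableEq ι] {C : Finset ι} (hC : Balanced a b C) {u : G}
    {l : List ι} (hn : l.Nodup) (hl : ∀ x ∈ l, x ∈ C) (hw : Walk a b u l u) :
    Balanced a b (C \ l.toFinset) := by
  have h := hC
  unfold Balanced at h ⊢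
  rw [val_eq_coe_add_sdiff hn hl, Multiset.map_add, Multiset.map_add,
    hw.multiset_eq_of_closed] at h
  exact add_left_cancel h

lemma Balanced.exists_euler_aux [DecidableEq ι] [DecidableEq G] {C : Finset ι}
    (hC : Balanced a b C) (i : ι) (hconn : ∀ j ∈ C, Reach a b C (a i) (a j)) (k : ℕ) :
    ∀ (l : List ι), (i :: l).Nodup → (∀ x ∈ i :: l, x ∈ C) →
      Walk a b (a i) (i :: l) (a i) → C.card ≤ l.length + k →
      ∃ l', (i :: l').Nodup ∧ (i :: l').toFinset = C ∧ Walk a b (a i) (i :: l') (a i) := by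
  induction k with
  | zero =>
    intro l hn hl hw hk
    have := Walk.length_le hn hl
    simp at this
    omega
  | succ k ih =>
    intro l hn hl hw hk
    by_cases hall : ∀ x ∈ C, x ∈ i :: l
    · refine ⟨l, hn, ?_, hw⟩
      ext x
      rw [List.mem_toFinset]
      exact ⟨fun h => hl x h, fun h => hall x h⟩
    push Not at hall
    obtain ⟨x, hxC, hxl⟩ := hall
    have hab := hw.multiset_eq_of_closed
    -- A vertex that is left by an edge of the trail is also entered by one, and by maximality
    -- some unused edge starts at such a vertex.
    have key : ∃ j ∈ C, j ∉ i :: l ∧ ∃ e ∈ i :: l, b e = a j := by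
      by_contra! hcon
      have hU : ∀ g, Reach a b C (a i) g → ∃ e ∈ i :: l, b e = g := by
        intro g hg
        induction hg with
        | refl =>
          have : a i ∈ ((i :: l : List ι) : Multiset ι).map b := by
            rw [hab]
            exact Multiset.mem_map_of_mem a (by simp)
          obtain ⟨e, he, hea⟩ := Multiset.mem_map.1 this
          exact ⟨e, by simpa using he, hea⟩
        | tail _ h2 ih2 =>
          obtain ⟨e, he, hea⟩ := ih2
          obtain ⟨j, hj, rfl, rfl⟩ := h2
          by_cases hjl : j ∈ i :: l
          · exact ⟨j, hjl, rfl⟩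
          · exact absurd hea (hcon j hj hjl e he)
      obtain ⟨e, he, hex⟩ := hU _ (hconn x hxC)
      exact hcon x hxC hxl e he hex
    obtain ⟨j, hjC, hjl, e, he, hej⟩ := key
    have hC' := hC.sdiff_of_closed hn hl hw
    have hj' : j ∈ C \ (i :: l).toFinset := by
      rw [Finset.mem_sdiff, List.mem_toFinset]
      exact ⟨hjC, hjl⟩
    obtain ⟨l', hn', hl', hw'⟩ := hC'.exists_closed hj'
    obtain ⟨l₁, l₂, hl12⟩ := List.append_of_mem he
    have hdis : ∀ y ∈ j :: l', y ∈ C ∧ y ∉ i :: l := by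
      intro y hy
      have := hl' y hy
      rwa [Finset.mem_sdiff, List.mem_toFinset] at this
    -- Splice the closed trail through `j` into the trail, right after the edge `e`.
    have hsplice : ∃ l₃, l₁ ++ e :: (j :: l' ++ l₂) = i :: l₃ := by
      cases l₁ with
      | nil =>
        simp only [List.nil_append, List.cons.injEq] at hl12
        exact ⟨j :: l' ++ l₂, by simp [hl12.1]⟩
      | cons z l₁ =>
        simp only [List.cons_append, List.cons.injEq] at hl12
        exact ⟨l₁ ++ e :: (j :: l' ++ l₂), by simp [hl12.1]⟩
    obtain ⟨l₃, hl₃⟩ := hsplice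
    have hperm : (i :: l₃).Perm ((i :: l) ++ (j :: l')) := by
      rw [← hl₃, hl12, List.append_assoc]
      refine List.Perm.append_left _ ?_
      have h : ((j :: l') ++ l₂).Perm (l₂ ++ (j :: l')) := List.perm_append_comm
      exact h.cons e
    refine ih l₃ ?_ ?_ ?_ ?_
    · rw [hperm.nodup_iff, List.nodup_append]
      refine ⟨hn, hn', ?_⟩
      rintro y hy z hz rfl
      exact (hdis y hz).2 hy
    · intro y hy
      rw [hperm.mem_iff, List.mem_append] at hy
      rcases hy with hy | hy
      · exact hl y hy
      · exact (hdis y hy).1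
    · rw [hl12, walk_append] at hw
      obtain ⟨z, hz1, hz2, hz3⟩ := hw
      rw [← hl₃, walk_append]
      refine ⟨z, hz1, hz2, ?_⟩
      rw [walk_append]
      rw [← hej] at hw'
      exact ⟨b e, hw', hz3⟩
    · have := hperm.length_eq
      simp only [List.length_append, List.length_cons] at this
      omega

/-- **Euler's theorem** for directed multigraphs: a balanced graph all of whose edges can be reached
from the source of the edge `i` has an Eulerian circuit that starts with `i`. -/
lemma Balanced.exists_euler [DecidableEq ι] [DecidableEq G] {C : Finset ι}
    (hC : Balanced a b C) {i : ι} (hi : i ∈ C) (hconn : ∀ j ∈ C, Reach a b C (a i) (a j)) :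
    ∃ l, (i :: l).Nodup ∧ (i :: l).toFinset = C ∧ Walk a b (a i) (i :: l) (a i) := by
  obtain ⟨l, hn, hl, hw⟩ := hC.exists_closed hi
  exact hC.exists_euler_aux i hconn C.card l hn hl hw (by omega)

end Euler

/-! ### Decomposition of balanced configurations into components -/

section Component

variable {ι G : Type*} {a b a' b' : ι → G} {C R : Finset ι}

lemma Balanced.congr (ha : ∀ i ∈ C, a i = a' i) (hb : ∀ i ∈ C, b i = b' i) :
    Balanced a b C ↔ Balanced a' b' C := by
  unfold Balanced
  rw [Multiset.map_congr rfl ha, Multiset.map_congr rfl hb]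

lemma Reach.mono_congr (hCR : C ⊆ R) (ha : ∀ i ∈ C, a i = a' i) (hb : ∀ i ∈ C, b i = b' i)
    {v g : G} (h : Reach a b C v g) : Reach a' b' R v g := by
  induction h with
  | refl => exact Relation.ReflTransGen.refl
  | tail _ h2 ih =>
    obtain ⟨i, hi, rfl, rfl⟩ := h2
    exact ih.tail ⟨i, hCR hi, (ha i hi).symm, (hb i hi).symm⟩

lemma val_eq_add_sdiff [DecidableEq ι] (hCR : C ⊆ R) : R.val = C.val + (R \ C).val := by
  rw [Finset.sdiff_val, add_comm, Multiset.sub_add_cancel]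
  exact Finset.val_le_iff.2 hCR

lemma Balanced.exists_target_eq (h : Balanced a b C) {i : ι} (hi : i ∈ C) :
    ∃ j ∈ C, a j = b i := by
  have h1 : b i ∈ C.val.map a := by
    rw [h]
    exact Multiset.mem_map_of_mem b hi
  exact Multiset.mem_map.1 h1

open scoped Classical in
lemma Balanced.filter_reach (h : Balanced a b R) (v : G) :
    Balanced a b (R.filter fun i => Reach a b R v (a i)) := by
  unfold Balanced at *
  rw [Finset.filter_val]
  have h1 : (R.val.filter fun i => Reach a b R v (a i)).map a =
      (R.val.map a).filter (Reach a b R v) := by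
    rw [Multiset.filter_map]; rfl
  have h2 : (R.val.filter fun i => Reach a b R v (a i)).map b ≤
      (R.val.map b).filter (Reach a b R v) := by
    rw [← Multiset.filter_eq_self (p := Reach a b R v)
      (s := (R.val.filter fun i => Reach a b R v (a i)).map b) |>.2]
    · exact Multiset.filter_le_filter _ (Multiset.map_le_map (Multiset.filter_le _ _))
    · intro g hg
      obtain ⟨i, hi, rfl⟩ := Multiset.mem_map.1 hg
      rw [Multiset.mem_filter] at hi
      exact hi.2.tail ⟨i, hi.1, rfl, rfl⟩
  symm
  refine Multiset.eq_of_le_of_card_le ?_ (by simp)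
  rw [h1, h]
  exact h2

/-- A balanced graph on the edge set `R` avoiding the vertices `V`, together with the edge set `C`
of the component of `v`, is the same as a balanced connected graph on `C` and a balanced graph
on `R \ C` that avoids `V` and all the vertices of the former. -/
lemma balanced_component_iff [DecidableEq ι] [DecidableEq G] {V : Finset G} {v : G} (hCR : C ⊆ R)
    (hne : C.Nonempty) :
    (Balanced a b R ∧ (∀ i ∈ R, a i ∉ V) ∧ ∀ i ∈ R, i ∈ C ↔ Reach a b R v (a i)) ↔
      (Balanced a b C ∧ (∀ i ∈ C, Reach a b C v (a i)) ∧ ∀ i ∈ C, a i ∉ V) ∧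
        Balanced a b (R \ C) ∧ ∀ i ∈ R \ C, a i ∉ V ∪ C.image a := by
  constructor
  · rintro ⟨hR, hV, hC⟩
    have hCb : Balanced a b C := by
      classical
      have h1 := hR.filter_reach v
      convert h1 using 1
      ext i
      rw [Finset.mem_filter]
      exact ⟨fun h => ⟨hCR h, (hC i (hCR h)).1 h⟩, fun h => (hC i h.1).2 h.2⟩
    have hreach : ∀ g, Reach a b R v g → Reach a b C v g := by
      intro g hg
      induction hg with
      | refl => exact Relation.ReflTransGen.refl
      | tail h1 h2 ih =>
        obtain ⟨i, hi, rfl, rfl⟩ := h2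
        exact ih.tail ⟨i, (hC i hi).2 h1, rfl, rfl⟩
    refine ⟨⟨hCb, fun i hi => hreach _ ((hC i (hCR hi)).1 hi), fun i hi => hV i (hCR hi)⟩, ?_, ?_⟩
    · have h := hR
      unfold Balanced at h hCb ⊢
      rw [val_eq_add_sdiff hCR, Multiset.map_add, Multiset.map_add, hCb] at h
      exact add_left_cancel h
    · intro i hi
      rw [Finset.mem_sdiff] at hi
      rw [Finset.mem_union, not_or]
      refine ⟨hV i hi.1, fun hmem => hi.2 ?_⟩
      obtain ⟨j, hj, hji⟩ := Finset.mem_image.1 hmem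
      rw [hC i hi.1, ← hji]
      exact (hC j (hCR hj)).1 hj
  · rintro ⟨⟨hCb, hreach, hCV⟩, hD, hDV⟩
    have hVR : ∀ i ∈ R, a i ∉ V := by
      intro i hi
      by_cases h : i ∈ C
      · exact hCV i h
      · have := hDV i (Finset.mem_sdiff.2 ⟨hi, h⟩)
        rw [Finset.mem_union, not_or] at this
        exact this.1
    have himg : ∀ i ∈ R, a i ∈ C.image a → i ∈ C := by
      intro i hi him
      by_contra h
      have := hDV i (Finset.mem_sdiff.2 ⟨hi, h⟩)
      rw [Finset.mem_union, not_or] at this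
      exact this.2 him
    have hv : v ∈ C.image a := by
      obtain ⟨i, hi⟩ := hne
      rcases Relation.ReflTransGen.cases_head (hreach i hi) with h | ⟨y, ⟨j, hj, hjv, -⟩, -⟩
      · rw [h]
        exact Finset.mem_image_of_mem a hi
      · rw [← hjv]
        exact Finset.mem_image_of_mem a hj
    have hsub : ∀ g, Reach a b R v g → g ∈ C.image a := by
      intro g hg
      induction hg with
      | refl => exact hv
      | tail h1 h2 ih =>
        obtain ⟨i, hi, rfl, rfl⟩ := h2
        obtain ⟨j, hj, hji⟩ := hCb.exists_target_eq (himg i hi ih)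
        rw [← hji]
        exact Finset.mem_image_of_mem a hj
    refine ⟨?_, hVR, fun i hi => ⟨fun h => ?_, fun h => himg i hi (hsub _ h)⟩⟩
    · unfold Balanced at *
      rw [val_eq_add_sdiff hCR, Multiset.map_add, Multiset.map_add, hCb, hD]
    · exact (hreach i h).mono_congr hCR (fun _ _ => rfl) (fun _ _ => rfl)

end Component

section Placement

variable {ι G : Type*} [Fintype ι] [DecidableEq ι] [AddCommGroup G] [Fintype G] [DecidableEq G]

/-- The placements `q` of the edges in `R`, normalized to be zero outside of `R`. -/
def placements (G : Type*) [AddCommGroup G] [Fintype G] [DecidableEq G] (R : Finset ι) :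
    Finset (ι → G) :=
  Finset.univ.filter fun q => ∀ i, i ∉ R → q i = 0

lemma mem_placements {R : Finset ι} {q : ι → G} :
    q ∈ placements G R ↔ ∀ i, i ∉ R → q i = 0 := by
  simp [placements]

lemma sum_placements_split {M : Type*} [AddCommMonoid M] {C R : Finset ι} (hCR : C ⊆ R)
    (F : (ι → G) → M) :
    ∑ q ∈ placements G R, F q =
      ∑ q₁ ∈ placements G C, ∑ q₂ ∈ placements G (R \ C), F (q₁ + q₂) := by
  rw [← Finset.sum_product']
  refine Finset.sum_nbij' (fun q => (fun i => if i ∈ C then q i else 0,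
    fun i => if i ∈ C then 0 else q i)) (fun p => p.1 + p.2) ?_ ?_ ?_ ?_ ?_
  · intro q hq
    rw [mem_placements] at hq
    rw [Finset.mem_product, mem_placements, mem_placements]
    refine ⟨fun i hi => by simp [hi], fun i hi => ?_⟩
    by_cases h : i ∈ C
    · simp [h]
    · have : i ∉ R := fun h' => hi (Finset.mem_sdiff.2 ⟨h', h⟩)
      simp [hq i this]
  · rintro ⟨q₁, q₂⟩ hp
    rw [Finset.mem_product, mem_placements, mem_placements] at hp
    rw [mem_placements]
    intro i hi
    have h1 := hp.1 i fun h => hi (hCR h)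
    have h2 := hp.2 i fun h => hi (Finset.mem_sdiff.1 h).1
    simp only at h1 h2
    simp [h1, h2]
  · intro q _
    ext i
    by_cases h : i ∈ C <;> simp [h]
  · rintro ⟨q₁, q₂⟩ hp
    rw [Finset.mem_product, mem_placements, mem_placements] at hp
    simp only at hp
    ext i
    · by_cases h : i ∈ C
      · have := hp.2 i (by simp [h])
        simp [h, this]
      · simp [h, hp.1 i h]
    · by_cases h : i ∈ C
      · have := hp.2 i (by simp [h])
        simp [h, this]
      · simp [h, hp.1 i h]
  · intro q _
    congr 1
    ext i
    by_cases h : i ∈ C <;> simp [h]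

/-- The placed edges in `C` form a balanced graph, all of whose vertices can be reached from `v`. -/
def IsComponent (s t : ι → G) (C : Finset ι) (v : G) (q : ι → G) : Prop :=
  Balanced (q + s) (q + t) C ∧ ∀ i ∈ C, Reach (q + s) (q + t) C v (q i + s i)

open scoped Classical in
/-- The sum of the weights `∏ c i (q i)` over all placements `q` of the edges in `R` for which the
edges `q i + s i → q i + t i` form a balanced graph that avoids the vertices in `V`. -/
noncomputable def balancedSum (s t : ι → G) (c : ι → G → ℂ) (R : Finset ι) (V : Finset G) : ℂ :=
  ∑ q ∈ placements G R, if Balanced (q + s) (q + t) R ∧ ∀ i ∈ R, q i + s i ∉ V then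
    ∏ i ∈ R, c i (q i) else 0

open scoped Classical in
/-- The part of `balancedSum` in which `C` is the set of edges of the component of a vertex
`v q`. -/
lemma sum_component_eq (s t : ι → G) (c : ι → G → ℂ) {C R : Finset ι} (V : Finset G)
    (v : (ι → G) → G) (hCR : C ⊆ R) (hne : C.Nonempty)
    (hv : ∀ q₁ q₂, q₂ ∈ placements G (R \ C) → v (q₁ + q₂) = v q₁) :
    (∑ q ∈ placements G R, if (Balanced (q + s) (q + t) R ∧ ∀ i ∈ R, q i + s i ∉ V) ∧
        ∀ i ∈ R, i ∈ C ↔ Reach (q + s) (q + t) R (v q) (q i + s i) then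
      ∏ i ∈ R, c i (q i) else 0) =
    ∑ q ∈ placements G C, if IsComponent s t C (v q) q ∧ ∀ i ∈ C, q i + s i ∉ V then
      (∏ i ∈ C, c i (q i)) * balancedSum s t c (R \ C) (V ∪ C.image (q + s)) else 0 := by
  rw [sum_placements_split hCR]
  refine Finset.sum_congr rfl fun q₁ hq₁ => ?_
  rw [mem_placements] at hq₁
  rw [balancedSum, Finset.mul_sum]
  have hsplit : ∀ q₂ ∈ placements G (R \ C),
      ((Balanced (q₁ + q₂ + s) (q₁ + q₂ + t) R ∧ ∀ i ∈ R, (q₁ + q₂) i + s i ∉ V) ∧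
        ∀ i ∈ R, i ∈ C ↔ Reach (q₁ + q₂ + s) (q₁ + q₂ + t) R (v (q₁ + q₂)) ((q₁ + q₂) i + s i)) ↔
      (IsComponent s t C (v q₁) q₁ ∧ ∀ i ∈ C, q₁ i + s i ∉ V) ∧
        (Balanced (q₂ + s) (q₂ + t) (R \ C) ∧
          ∀ i ∈ R \ C, q₂ i + s i ∉ V ∪ C.image (q₁ + s)) := by
    intro q₂ hq₂
    rw [hv q₁ q₂ hq₂]
    rw [mem_placements] at hq₂
    have h2 : ∀ i ∈ C, q₂ i = 0 := fun i hi => hq₂ i (by simp [hi])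
    have h1 : ∀ i ∈ R \ C, q₁ i = 0 := fun i hi => hq₁ i (Finset.mem_sdiff.1 hi).2
    have hs : ∀ i ∈ C, (q₁ + q₂ + s) i = (q₁ + s) i := fun i hi => by simp [h2 i hi]
    have ht : ∀ i ∈ C, (q₁ + q₂ + t) i = (q₁ + t) i := fun i hi => by simp [h2 i hi]
    have hs' : ∀ i ∈ R \ C, (q₁ + q₂ + s) i = (q₂ + s) i := fun i hi => by simp [h1 i hi]
    have ht' : ∀ i ∈ R \ C, (q₁ + q₂ + t) i = (q₂ + t) i := fun i hi => by simp [h1 i hi]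
    have key := balanced_component_iff (a := q₁ + q₂ + s) (b := q₁ + q₂ + t) (V := V) (v := v q₁)
      hCR hne
    rw [Balanced.congr hs ht, Balanced.congr hs' ht', Finset.image_congr hs] at key
    have e1 : (∀ i ∈ C, Reach (q₁ + q₂ + s) (q₁ + q₂ + t) C (v q₁) ((q₁ + q₂ + s) i)) ↔
        ∀ i ∈ C, Reach (q₁ + s) (q₁ + t) C (v q₁) (q₁ i + s i) := by
      refine forall₂_congr fun i hi => ?_
      rw [hs i hi]
      exact ⟨fun h => h.mono_congr subset_rfl hs ht,
        fun h => h.mono_congr subset_rfl (fun i hi => (hs i hi).symm) fun i hi => (ht i hi).symm⟩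
    have e2 : (∀ i ∈ C, (q₁ + q₂ + s) i ∉ V) ↔ ∀ i ∈ C, q₁ i + s i ∉ V :=
      forall₂_congr fun i hi => by rw [hs i hi]; rfl
    have e3 : (∀ i ∈ R \ C, (q₁ + q₂ + s) i ∉ V ∪ C.image (q₁ + s)) ↔
        ∀ i ∈ R \ C, q₂ i + s i ∉ V ∪ C.image (q₁ + s) :=
      forall₂_congr fun i hi => by rw [hs' i hi]; rfl
    rw [e1, e2, e3] at key
    unfold IsComponent
    rw [and_assoc, and_assoc (a := Balanced (q₁ + s) (q₁ + t) C)]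
    exact key
  have hprod : ∀ q₂ ∈ placements G (R \ C), ∏ i ∈ R, c i ((q₁ + q₂) i) =
      (∏ i ∈ C, c i (q₁ i)) * ∏ i ∈ R \ C, c i (q₂ i) := by
    intro q₂ hq₂
    rw [mem_placements] at hq₂
    rw [← Finset.prod_sdiff hCR, mul_comm]
    congr 1
    · refine Finset.prod_congr rfl fun i hi => ?_
      rw [Pi.add_apply, hq₂ i (by simp [hi]), add_zero]
    · refine Finset.prod_congr rfl fun i hi => ?_
      rw [Pi.add_apply, hq₁ i (Finset.mem_sdiff.1 hi).2, zero_add]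
  by_cases hP : IsComponent s t C (v q₁) q₁ ∧ ∀ i ∈ C, q₁ i + s i ∉ V
  · rw [if_pos hP]
    refine Finset.sum_congr rfl fun q₂ hq₂ => ?_
    rw [if_congr (hsplit q₂ hq₂) (hprod q₂ hq₂) rfl]
    rw [mul_ite, mul_zero]
    exact if_congr (and_iff_right hP) rfl rfl
  · rw [if_neg hP]
    refine Finset.sum_eq_zero fun q₂ hq₂ => ?_
    rw [if_neg]
    rw [hsplit q₂ hq₂]
    exact fun h => hP h.1

open scoped Classical in
/-- Removing the component of a vertex `v` that is used by some edge. -/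
lemma balancedSum_eq_insert_add (s t : ι → G) (c : ι → G → ℂ) (R : Finset ι) (V : Finset G)
    (v : G) :
    balancedSum s t c R V = balancedSum s t c R (insert v V) +
      ∑ C ∈ R.powerset.filter Finset.Nonempty,
        ∑ q ∈ placements G C, if IsComponent s t C v q ∧ ∀ i ∈ C, q i + s i ∉ V then
          (∏ i ∈ C, c i (q i)) * balancedSum s t c (R \ C) (V ∪ C.image (q + s)) else 0 := by
  have h1 : ∀ C ∈ R.powerset.filter Finset.Nonempty, _ = _ := fun C hC =>
    (sum_component_eq s t c (R := R) V (fun _ => v)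
      (Finset.mem_powerset.1 (Finset.mem_filter.1 hC).1)
      (Finset.mem_filter.1 hC).2 (fun _ _ _ => rfl)).symm
  rw [Finset.sum_congr rfl h1, Finset.sum_comm, balancedSum, balancedSum,
    ← Finset.sum_add_distrib]
  refine Finset.sum_congr rfl fun q _ => ?_
  by_cases hP : Balanced (q + s) (q + t) R ∧ ∀ i ∈ R, q i + s i ∉ V
  · rw [if_pos hP]
    have hP' := eq_true hP.2
    simp only [hP.1, hP', true_and]
    set C₀ := R.filter fun i => Reach (q + s) (q + t) R v (q i + s i) with hC₀
    have hsum : ∀ C ∈ R.powerset.filter Finset.Nonempty,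
        (if ∀ i ∈ R, i ∈ C ↔ Reach (q + s) (q + t) R v (q i + s i) then
          ∏ i ∈ R, c i (q i) else 0) = if C = C₀ then ∏ i ∈ R, c i (q i) else 0 := by
      intro C hC
      refine if_congr ?_ rfl rfl
      have hCR := Finset.mem_powerset.1 (Finset.mem_filter.1 hC).1
      constructor
      · intro h
        ext i
        rw [hC₀, Finset.mem_filter]
        exact ⟨fun hi => ⟨hCR hi, (h i (hCR hi)).1 hi⟩, fun hi => (h i hi.1).2 hi.2⟩
      · rintro rfl i hi
        rw [hC₀, Finset.mem_filter]
        exact ⟨fun h => h.2, fun h => ⟨hi, h⟩⟩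
    rw [Finset.sum_congr rfl hsum, Finset.sum_ite_eq']
    have hmem : C₀ ∈ R.powerset.filter Finset.Nonempty ↔ ∃ i ∈ R, q i + s i = v := by
      rw [Finset.mem_filter, Finset.mem_powerset]
      constructor
      · rintro ⟨-, i, hi⟩
        rw [hC₀, Finset.mem_filter] at hi
        rcases Relation.ReflTransGen.cases_head hi.2 with h | ⟨y, ⟨j, hj, hjv, -⟩, -⟩
        · exact ⟨i, hi.1, h.symm⟩
        · exact ⟨j, hj, hjv⟩
      · rintro ⟨i, hi, rfl⟩
        refine ⟨Finset.filter_subset _ _, i, ?_⟩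
        rw [hC₀, Finset.mem_filter]
        exact ⟨hi, Relation.ReflTransGen.refl⟩
    by_cases hex : ∃ i ∈ R, q i + s i = v
    · rw [if_pos (hmem.2 hex), if_neg, zero_add]
      obtain ⟨i, hi, hiv⟩ := hex
      intro h
      exact h i hi (by rw [hiv]; exact Finset.mem_insert_self _ _)
    · rw [if_neg (fun h => hex (hmem.1 h)), add_zero, if_pos]
      intro i hi h
      rw [Finset.mem_insert] at h
      rcases h with h | h
      · exact hex ⟨i, hi, h⟩
      · exact hP.2 i hi h
  · rw [if_neg hP, if_neg, zero_add]
    · symm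
      refine Finset.sum_eq_zero fun C _ => ?_
      rw [if_neg]
      exact fun h => hP h.1
    · refine fun h => hP ⟨h.1, fun i hi hV => h.2 i hi (Finset.mem_insert_of_mem hV)⟩

open scoped Classical in
/-- Removing the component of the edge `i`. -/
lemma balancedSum_empty_eq (s t : ι → G) (c : ι → G → ℂ) {R : Finset ι} {i : ι} (hi : i ∈ R) :
    balancedSum s t c R ∅ = ∑ C ∈ R.powerset.filter (i ∈ ·),
        ∑ q ∈ placements G C, if IsComponent s t C (q i + s i) q then
          (∏ j ∈ C, c j (q j)) * balancedSum s t c (R \ C) (C.image (q + s)) else 0 := by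
  have h1 : ∀ C ∈ R.powerset.filter (i ∈ ·), _ = _ := fun C hC =>
    (sum_component_eq s t c (R := R) ∅ (fun q => q i + s i)
      (Finset.mem_powerset.1 (Finset.mem_filter.1 hC).1)
      ⟨i, (Finset.mem_filter.1 hC).2⟩ (fun q₁ q₂ hq₂ => by
        rw [mem_placements] at hq₂
        have := hq₂ i (by simp [(Finset.mem_filter.1 hC).2])
        simp [this])).symm
  simp only [Finset.notMem_empty, not_false_eq_true, implies_true, and_true,
    Finset.empty_union] at h1
  rw [Finset.sum_congr rfl h1, Finset.sum_comm, balancedSum]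
  refine Finset.sum_congr rfl fun q _ => ?_
  simp only [Finset.notMem_empty, not_false_eq_true, implies_true, and_true]
  by_cases hP : Balanced (q + s) (q + t) R
  · simp only [hP, true_and, if_true]
    set C₀ := R.filter fun j => Reach (q + s) (q + t) R (q i + s i) (q j + s j) with hC₀
    have hsum : ∀ C ∈ R.powerset.filter (i ∈ ·),
        (if ∀ j ∈ R, j ∈ C ↔ Reach (q + s) (q + t) R (q i + s i) (q j + s j) then
          ∏ i ∈ R, c i (q i) else 0) = if C = C₀ then ∏ i ∈ R, c i (q i) else 0 := by
      intro C hC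
      refine if_congr ?_ rfl rfl
      have hCR := Finset.mem_powerset.1 (Finset.mem_filter.1 hC).1
      constructor
      · intro h
        ext j
        rw [hC₀, Finset.mem_filter]
        exact ⟨fun hi => ⟨hCR hi, (h j (hCR hi)).1 hi⟩, fun hi => (h j hi.1).2 hi.2⟩
      · rintro rfl j hj
        rw [hC₀, Finset.mem_filter]
        exact ⟨fun h => h.2, fun h => ⟨hj, h⟩⟩
    rw [Finset.sum_congr rfl hsum, Finset.sum_ite_eq', if_pos]
    rw [Finset.mem_filter, Finset.mem_powerset]
    refine ⟨Finset.filter_subset _ _, ?_⟩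
    rw [hC₀, Finset.mem_filter]
    exact ⟨hi, Relation.ReflTransGen.refl⟩
  · simp [hP]

end Placement

/-! ### Counting components, and configurations that avoid given vertices -/

section Count

variable {ι G : Type*} [Fintype ι] [DecidableEq ι] [AddCommGroup G] [Fintype G] [DecidableEq G]
  {s t : ι → G} {C : Finset ι}

omit [Fintype ι] [DecidableEq ι] [Fintype G] [DecidableEq G] in
lemma Walk.placement_eq {q q' : ι → G} {u w w' : G} {l : List ι}
    (h : Walk (q + s) (q + t) u l w) (h' : Walk (q' + s) (q' + t) u l w') :
    ∀ j ∈ l, q j = q' j := by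
  induction l generalizing u with
  | nil => simp
  | cons x l ih =>
    obtain ⟨h1, h2⟩ := h
    obtain ⟨h1', h2'⟩ := h'
    have hx : q x = q' x := by
      rw [← h1'] at h1
      simpa using h1
    have hb : (q + t) x = (q' + t) x := by simp [hx]
    rw [hb] at h2
    intro j hj
    rcases List.mem_cons.1 hj with rfl | hj
    · exact hx
    · exact ih h2 h2' j hj

omit [Fintype ι] [DecidableEq ι] [Fintype G] [DecidableEq G] in
lemma IsComponent.exists_source_eq {q : ι → G} {v : G} (h : IsComponent s t C v q)
    (hne : C.Nonempty) : ∃ i ∈ C, q i + s i = v := by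
  obtain ⟨i, hi⟩ := hne
  rcases Relation.ReflTransGen.cases_head (h.2 i hi) with h | ⟨y, ⟨j, hj, hjv, -⟩, -⟩
  · exact ⟨i, hi, h.symm⟩
  · exact ⟨j, hj, hjv⟩

omit [Fintype ι] [DecidableEq ι] [Fintype G] [DecidableEq G] in
lemma IsComponent.two_le_card {q : ι → G} {v : G} (h : IsComponent s t C v q)
    (hst : ∀ i, s i ≠ t i) (hne : C.Nonempty) : 2 ≤ C.card := by
  by_contra hlt
  have h1 : C.card = 1 := by
    have := hne.card_pos
    omega
  obtain ⟨i, rfl⟩ := Finset.card_eq_one.1 h1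
  have h2 := h.1
  simp [Balanced] at h2
  exact hst i h2

open scoped Classical in
/-- An Eulerian circuit through the edges in `C` that starts with the edge `i` at `v` determines the
placement of the edges, so there are at most as many placements as orderings of `C`. -/
lemma card_component_le {i : ι} (hi : i ∈ C) (v : G) :
    ((placements G C).filter fun q => IsComponent s t C v q ∧ q i + s i = v).card ≤
      (C.card - 1).factorial := by
  have hex : ∀ q ∈ (placements G C).filter fun q => IsComponent s t C v q ∧ q i + s i = v,
      ∃ l : List ι, (i :: l).Nodup ∧ (i :: l).toFinset = C ∧
        Walk (q + s) (q + t) v (i :: l) v := by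
    intro q hq
    obtain ⟨-, hq1, rfl⟩ := Finset.mem_filter.1 hq
    exact hq1.1.exists_euler hi hq1.2
  choose! f hf1 hf2 hf3 using hex
  calc _ ≤ ((C.erase i).toList.permutations.toFinset).card := by
        refine Finset.card_le_card_of_injOn f ?_ ?_
        · intro q hq
          have h1 := hf1 q hq
          have h2 := hf2 q hq
          rw [List.nodup_cons] at h1
          rw [Finset.mem_coe, List.mem_toFinset, List.mem_permutations]
          refine List.perm_of_nodup_nodup_toFinset_eq h1.2 (Finset.nodup_toList _) ?_
          rw [Finset.toList_toFinset, ← h2, List.toFinset_cons, Finset.erase_insert]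
          rw [List.mem_toFinset]
          exact h1.1
        · intro q hq q' hq' hqq
          have h1 := hf3 q hq
          have h2 := hf3 q' hq'
          rw [← hqq] at h2
          have h3 := h1.placement_eq h2
          have hC := hf2 q hq
          ext j
          by_cases hj : j ∈ C
          · refine h3 j ?_
            rw [← List.mem_toFinset, hC]
            exact hj
          · rw [mem_placements.1 (Finset.mem_filter.1 hq).1 j hj,
              mem_placements.1 (Finset.mem_filter.1 hq').1 j hj]
    _ ≤ (C.erase i).toList.permutations.length := List.toFinset_card_le _
    _ = (C.card - 1).factorial := by
        rw [List.length_permutations, Finset.length_toList, Finset.card_erase_of_mem hi]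

open scoped Classical in
lemma card_component_le' (hne : C.Nonempty) (v : G) :
    ((placements G C).filter fun q => IsComponent s t C v q).card ≤ C.card.factorial := by
  calc _ ≤ (C.biUnion fun i =>
        (placements G C).filter fun q => IsComponent s t C v q ∧ q i + s i = v).card := by
        refine Finset.card_le_card fun q hq => ?_
        rw [Finset.mem_filter] at hq
        obtain ⟨i, hi, hiv⟩ := hq.2.exists_source_eq hne
        exact Finset.mem_biUnion.2 ⟨i, hi, Finset.mem_filter.2 ⟨hq.1, hq.2, hiv⟩⟩
    _ ≤ ∑ i ∈ C, _ := Finset.card_biUnion_le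
    _ ≤ ∑ i ∈ C, (C.card - 1).factorial := Finset.sum_le_sum fun i hi => card_component_le hi v
    _ = C.card.factorial := by
        rw [Finset.sum_const, smul_eq_mul, Nat.mul_factorial_pred hne.card_pos.ne']

open scoped Classical in
lemma card_component_le_card_mul {i : ι} (hi : i ∈ C) :
    ((placements G C).filter fun q => IsComponent s t C (q i + s i) q).card ≤
      Fintype.card G * (C.card - 1).factorial := by
  calc _ ≤ (Finset.univ.biUnion fun v : G =>
        (placements G C).filter fun q => IsComponent s t C v q ∧ q i + s i = v).card := by
        refine Finset.card_le_card fun q hq => ?_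
        rw [Finset.mem_filter] at hq
        exact Finset.mem_biUnion.2 ⟨_, Finset.mem_univ _, Finset.mem_filter.2 ⟨hq.1, hq.2, rfl⟩⟩
    _ ≤ ∑ v : G, _ := Finset.card_biUnion_le
    _ ≤ ∑ v : G, (C.card - 1).factorial := Finset.sum_le_sum fun v _ => card_component_le hi v
    _ = _ := by rw [Finset.sum_const, smul_eq_mul, Finset.card_univ]

end Count

section Expansion

/-- Choosing disjoint `C` and `D` in `R` amounts to choosing `E = C ∪ D` and `C ⊆ E`. -/
lemma sum_powerset_sdiff_comm {ι M : Type*} [DecidableEq ι] [AddCommMonoid M] (R : Finset ι)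
    (p : Finset ι → Prop) [DecidablePred p] (F : Finset ι → Finset ι → Finset ι → M) :
    ∑ C ∈ R.powerset.filter p, ∑ D ∈ (R \ C).powerset, F C D ((R \ C) \ D) =
      ∑ E ∈ R.powerset, ∑ C ∈ E.powerset.filter p, F C (E \ C) (R \ E) := by
  rw [Finset.sum_sigma', Finset.sum_sigma']
  refine Finset.sum_nbij' (fun x => ⟨x.1 ∪ x.2, x.1⟩) (fun x => ⟨x.2, x.1 \ x.2⟩) ?_ ?_ ?_ ?_ ?_
  · rintro ⟨C, D⟩ h
    simp only [Finset.mem_sigma, Finset.mem_filter, Finset.mem_powerset] at h ⊢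
    exact ⟨Finset.union_subset h.1.1 (h.2.trans Finset.sdiff_subset), Finset.subset_union_left,
      h.1.2⟩
  · rintro ⟨E, C⟩ h
    simp only [Finset.mem_sigma, Finset.mem_filter, Finset.mem_powerset] at h ⊢
    exact ⟨⟨h.2.1.trans h.1, h.2.2⟩, Finset.sdiff_subset_sdiff h.1 subset_rfl⟩
  · rintro ⟨C, D⟩ h
    simp only [Finset.mem_sigma, Finset.mem_filter, Finset.mem_powerset] at h
    have : (C ∪ D) \ C = D := by
      rw [Finset.union_sdiff_cancel_left]
      exact (Finset.disjoint_of_subset_left h.2 Finset.sdiff_disjoint).symm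
    simp only [this]
  · rintro ⟨E, C⟩ h
    simp only [Finset.mem_sigma, Finset.mem_filter, Finset.mem_powerset] at h
    simp only [Finset.union_sdiff_of_subset h.2.1]
  · rintro ⟨C, D⟩ h
    simp only [Finset.mem_sigma, Finset.mem_filter, Finset.mem_powerset] at h
    have : (C ∪ D) \ C = D := by
      rw [Finset.union_sdiff_cancel_left]
      exact (Finset.disjoint_of_subset_left h.2 Finset.sdiff_disjoint).symm
    simp only [this, sdiff_sdiff_left, Finset.sup_eq_union]

lemma sum_Ico_half_pow (m : ℕ) : ∑ c ∈ Finset.Ico 2 (m + 2), (1 / 2 : ℝ) ^ c =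
    1 / 2 - (1 / 2) ^ (m + 1) := by
  induction m with
  | zero => simp
  | succ m ih =>
    rw [Finset.sum_Ico_succ_top (by omega), ih]
    ring

variable {ι G : Type*} [Fintype ι] [DecidableEq ι] [AddCommGroup G] [Fintype G] [DecidableEq G]
  {s t : ι → G} {c : ι → G → ℂ}

lemma balancedSum_empty (V : Finset G) : balancedSum s t c ∅ V = 1 := by
  have h : placements G (∅ : Finset ι) = {0} := by
    ext q
    rw [mem_placements, Finset.mem_singleton]
    simp [funext_iff]
  simp [balancedSum, h, Balanced]

lemma norm_sum_component_le (hc : ∀ i g, ‖c i g‖ ≤ 1) {C : Finset ι}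
    (p : (ι → G) → Prop) [DecidablePred p] (F : Finset G → ℂ) {B : ℕ → ℝ} (hB : Monotone B)
    (hF : ∀ V : Finset G, ‖F V‖ ≤ B V.card) (V : Finset G) :
    ‖∑ q ∈ placements G C, if p q then (∏ i ∈ C, c i (q i)) * F (V ∪ C.image (q + s)) else 0‖ ≤
      ((placements G C).filter p).card * B (V.card + C.card) := by
  rw [← Finset.sum_filter, ← nsmul_eq_mul]
  refine (norm_sum_le _ _).trans (Finset.sum_le_card_nsmul _ _ _ fun q _ => ?_)
  rw [norm_mul, norm_prod]
  calc _ ≤ 1 * B (V ∪ C.image (q + s)).card :=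
        mul_le_mul (Finset.prod_le_one (fun _ _ => norm_nonneg _) fun i _ => hc i _) (hF _)
          (norm_nonneg _) zero_le_one
    _ ≤ B (V.card + C.card) := by
        rw [one_mul]
        exact hB ((Finset.card_union_le _ _).trans
          (Nat.add_le_add_left Finset.card_image_le _))

/-- Splitting off `k` of `d` edges, in `k!` ways each, costs a factor `2 ^ (-k)` relative to the bound
`d! * 3 ^ d * (3 / 2) ^ v`, even though it adds `k` vertices to the `v` forbidden ones. -/
lemma choose_mul_half_pow {d k : ℕ} (hk : k ≤ d) (v : ℕ) :
    (d.choose k : ℝ) * (k.factorial * ((d - k).factorial * 3 ^ (d - k) * (3 / 2) ^ (v + k))) =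
      d.factorial * 3 ^ d * (3 / 2) ^ v * (1 / 2) ^ k := by
  have h1 : (d.choose k : ℝ) * k.factorial * (d - k).factorial = d.factorial := by
    exact_mod_cast Nat.choose_mul_factorial_mul_factorial hk
  have h2 : (3 : ℝ) ^ (d - k) * 3 ^ k = 3 ^ d := by
    rw [← pow_add, Nat.sub_add_cancel hk]
  calc _ = (d.choose k : ℝ) * k.factorial * (d - k).factorial * 3 ^ (d - k) *
        (3 / 2) ^ v * (3 / 2) ^ k := by rw [pow_add]; ring
    _ = d.factorial * (3 ^ (d - k) * 3 ^ k) * (3 / 2) ^ v * (1 / 2) ^ k := by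
        rw [h1, show (3 / 2 : ℝ) = 3 * (1 / 2) by norm_num, mul_pow 3 (1 / 2) k]
        ring
    _ = _ := by rw [h2]

open scoped Classical in
/-- The sum over the configurations that avoid `V` is a linear combination of unrestricted sums over
smaller edge sets. Forbidding one more vertex `v` subtracts the configurations in which `v` lies on
a component `C`, and the remaining edges then have to avoid the vertices of `C` as well. The
coefficients satisfy `z (V ∪ {v}) D = z V D - ∑ z (V ∪ V(C)) (D \ C)`, and the bases `3` and `3 / 2`
are such that a component of `k ≥ 2` edges costs a factor `2 ^ (-k)`, which adds up to
`1 + 1 / 2 = 3 / 2`. -/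
lemma exists_avoiding_expansion (hst : ∀ i, s i ≠ t i) (hc : ∀ i g, ‖c i g‖ ≤ 1) (d : ℕ) :
    ∃ z : Finset G → Finset ι → ℂ,
      (∀ V R, R.card ≤ d → balancedSum s t c R V =
        ∑ D ∈ R.powerset, z V D * balancedSum s t c (R \ D) ∅) ∧
      ∀ V D, D.card ≤ d → ‖z V D‖ ≤ D.card.factorial * 3 ^ D.card * (3 / 2) ^ V.card := by
  induction d with
  | zero =>
    refine ⟨fun _ _ => 1, ?_, ?_⟩
    · intro V R hR
      rw [Nat.le_zero, Finset.card_eq_zero] at hR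
      subst hR
      simp [balancedSum_empty]
    · intro V D hD
      rw [Nat.le_zero] at hD
      rw [hD]
      simpa using one_le_pow₀ (by norm_num : (1 : ℝ) ≤ 3 / 2)
  | succ d ih =>
    obtain ⟨z₀, hz₀, hb₀⟩ := ih
    suffices h : ∀ V : Finset G, ∃ z : Finset ι → ℂ,
        (∀ R, R.card ≤ d + 1 → balancedSum s t c R V =
          ∑ D ∈ R.powerset, z D * balancedSum s t c (R \ D) ∅) ∧
        ∀ D, D.card ≤ d + 1 → ‖z D‖ ≤ D.card.factorial * 3 ^ D.card * (3 / 2) ^ V.card by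
      choose z hz using h
      exact ⟨z, fun V => (hz V).1, fun V => (hz V).2⟩
    intro V
    induction V using Finset.induction_on with
    | empty =>
      refine ⟨fun D => if D = ∅ then 1 else 0, ?_, ?_⟩
      · intro R _
        simp [ite_mul, Finset.sum_ite_eq']
      · intro D _
        by_cases hD : D = ∅
        · simp [hD]
        · simp only [if_neg hD, norm_zero]
          positivity
    | insert v V hv ihV =>
      obtain ⟨z, hz, hb⟩ := ihV
      refine ⟨fun D => z D - ∑ C ∈ D.powerset.filter Finset.Nonempty,
        ∑ q ∈ placements G C, if IsComponent s t C v q ∧ ∀ i ∈ C, q i + s i ∉ V then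
          (∏ i ∈ C, c i (q i)) * z₀ (V ∪ C.image (q + s)) (D \ C) else 0, ?_, ?_⟩
      · intro R hR
        have h1 := balancedSum_eq_insert_add s t c R V v
        rw [← sub_eq_iff_eq_add] at h1
        rw [← h1, hz R hR]
        simp only [sub_mul]
        rw [Finset.sum_sub_distrib]
        congr 1
        simp only [Finset.sum_mul]
        rw [← sum_powerset_sdiff_comm R Finset.Nonempty fun C D E =>
          ∑ q ∈ placements G C, (if IsComponent s t C v q ∧ ∀ i ∈ C, q i + s i ∉ V then
            (∏ i ∈ C, c i (q i)) * z₀ (V ∪ C.image (q + s)) D else 0) *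
              balancedSum s t c E ∅]
        refine Finset.sum_congr rfl fun C hC => ?_
        rw [Finset.sum_comm]
        refine Finset.sum_congr rfl fun q _ => ?_
        by_cases hP : IsComponent s t C v q ∧ ∀ i ∈ C, q i + s i ∉ V
        · simp only [if_pos hP]
          rw [hz₀, Finset.mul_sum]
          · refine Finset.sum_congr rfl fun D _ => ?_
            rw [mul_assoc]
          · obtain ⟨hCR, hne⟩ := Finset.mem_filter.1 hC
            rw [Finset.card_sdiff_of_subset (Finset.mem_powerset.1 hCR)]
            have := hne.card_pos
            omega
        · simp only [if_neg hP, zero_mul, Finset.sum_const_zero]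
      · intro D hD
        set B : ℕ → ℝ := fun k => if k < 2 then 0 else
          k.factorial * ((D.card - k).factorial * 3 ^ (D.card - k) * (3 / 2) ^ (V.card + k))
          with hBdef
        have hBnn : ∀ k, 0 ≤ B k := fun k => by
          simp only [hBdef]
          split_ifs <;> positivity
        have h1 : ‖∑ C ∈ D.powerset.filter Finset.Nonempty,
            ∑ q ∈ placements G C, if IsComponent s t C v q ∧ ∀ i ∈ C, q i + s i ∉ V then
              (∏ i ∈ C, c i (q i)) * z₀ (V ∪ C.image (q + s)) (D \ C) else 0‖ ≤
            ∑ C ∈ D.powerset, B C.card := by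
          refine (norm_sum_le _ _).trans (le_trans (Finset.sum_le_sum fun C hC => ?_)
            (Finset.sum_le_sum_of_subset_of_nonneg (Finset.filter_subset _ _)
              fun C _ _ => hBnn _))
          obtain ⟨hCD, hne⟩ := Finset.mem_filter.1 hC
          rw [Finset.mem_powerset] at hCD
          have hcard : (D \ C).card = D.card - C.card := Finset.card_sdiff_of_subset hCD
          by_cases h2 : 2 ≤ C.card
          · have hB1 : B C.card = C.card.factorial * ((D.card - C.card).factorial *
                3 ^ (D.card - C.card) * (3 / 2) ^ (V.card + C.card)) := by
              simp only [hBdef]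
              rw [if_neg (by omega)]
            rw [hB1]
            refine (norm_sum_component_le hc _ (fun W => z₀ W (D \ C))
              (B := fun k => (D.card - C.card).factorial * 3 ^ (D.card - C.card) * (3 / 2) ^ k)
              ?_ ?_ V).trans ?_
            · intro k k' hk
              dsimp only
              gcongr
              norm_num
            · intro W
              have := hb₀ W (D \ C) (by rw [hcard]; omega)
              rwa [hcard] at this
            · gcongr
              refine le_trans (Finset.card_le_card ?_) (card_component_le' (s := s) (t := t) hne v)
              exact Finset.monotone_filter_right _ fun q _ hq => hq.1
          · rw [Finset.sum_eq_zero]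
            · simpa using hBnn _
            · intro q _
              rw [if_neg]
              exact fun h => h2 (h.1.two_le_card hst hne)
        have h2 : ∑ C ∈ D.powerset, B C.card ≤
            D.card.factorial * 3 ^ D.card * (3 / 2) ^ V.card * (1 / 2) := by
          rw [Finset.sum_powerset_apply_card]
          calc ∑ k ∈ Finset.range (D.card + 1), D.card.choose k • B k
              ≤ ∑ k ∈ Finset.range (D.card + 2), if 2 ≤ k then
                D.card.factorial * 3 ^ D.card * (3 / 2 : ℝ) ^ V.card * (1 / 2) ^ k else 0 := by
                refine (Finset.sum_le_sum (g := fun k => if 2 ≤ k then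
                  D.card.factorial * 3 ^ D.card * (3 / 2 : ℝ) ^ V.card * (1 / 2) ^ k else 0)
                  fun k hk => ?_).trans
                  (Finset.sum_le_sum_of_subset_of_nonneg
                    (Finset.range_mono (Nat.le_succ _)) fun k _ _ => ?_)
                · rw [Finset.mem_range] at hk
                  simp only [hBdef]
                  by_cases h2 : 2 ≤ k
                  · rw [if_neg (by omega), if_pos h2, nsmul_eq_mul,
                      choose_mul_half_pow (by omega)]
                  · rw [if_pos (by omega), if_neg h2, smul_zero]
                · split_ifs <;> positivity
            _ = D.card.factorial * 3 ^ D.card * (3 / 2) ^ V.card *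
                ∑ k ∈ Finset.Ico 2 (D.card + 2), (1 / 2 : ℝ) ^ k := by
                rw [← Finset.sum_filter, Finset.mul_sum]
                refine Finset.sum_congr ?_ fun _ _ => rfl
                ext k
                simp only [Finset.mem_filter, Finset.mem_range, Finset.mem_Ico]
                omega
            _ ≤ _ := by
                rw [sum_Ico_half_pow]
                gcongr
                have : (0 : ℝ) ≤ (1 / 2) ^ (D.card + 1) := by positivity
                linarith
        rw [Finset.card_insert_of_notMem hv, pow_succ]
        calc _ ≤ ‖z D‖ + _ := norm_sub_le _ _
          _ ≤ _ := add_le_add (hb D hD) (h1.trans h2)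
          _ = _ := by ring

end Expansion

/-! ### Cluster expansion and sums over partitions -/

section Cluster

variable {ι G : Type*} [Fintype ι] [DecidableEq ι] [AddCommGroup G] [Fintype G] [DecidableEq G]
  {s t : ι → G} {c : ι → G → ℂ}

/-- The bound `(k - 1)! * 3 ^ k * (1 / 2 - 1 / 2 ^ k)` for the weight of a cluster of `k` edges, up
to the number of its translates. -/
noncomputable def clusterWeight (k : ℕ) : ℝ :=
  (k - 1).factorial * (3 ^ k * (1 / 2 - (1 / 2) ^ k))

lemma clusterWeight_nonneg {k : ℕ} (hk : k ≠ 0) : 0 ≤ clusterWeight k := by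
  unfold clusterWeight
  have : (1 / 2 : ℝ) ^ k ≤ 1 / 2 := pow_le_of_le_one (by norm_num) (by norm_num) hk
  have h2 : (0 : ℝ) ≤ 1 / 2 - (1 / 2) ^ k := by linarith
  positivity

omit [Fintype ι] in
lemma sum_powerset_filter_mem {i : ι} {E : Finset ι} (hi : i ∈ E) (f : Finset ι → ℝ) :
    ∑ C ∈ E.powerset.filter (i ∈ ·), f C = ∑ C ∈ (E.erase i).powerset, f (insert i C) := by
  refine Finset.sum_nbij' (fun C => C.erase i) (fun C => insert i C) ?_ ?_ ?_ ?_ ?_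
  · intro C hC
    rw [Finset.mem_filter, Finset.mem_powerset] at hC
    rw [Finset.mem_powerset]
    exact Finset.erase_subset_erase _ hC.1
  · intro C hC
    rw [Finset.mem_powerset] at hC
    rw [Finset.mem_filter, Finset.mem_powerset]
    exact ⟨Finset.insert_subset hi (hC.trans (Finset.erase_subset _ _)),
      Finset.mem_insert_self _ _⟩
  · intro C hC
    exact Finset.insert_erase (Finset.mem_filter.1 hC).2
  · intro C hC
    rw [Finset.mem_powerset] at hC
    exact Finset.erase_insert fun h => Finset.notMem_erase i E (hC h)
  · intro C hC
    rw [Finset.insert_erase (Finset.mem_filter.1 hC).2]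

open scoped Classical in
/-- The cluster expansion: the sum over all balanced configurations is obtained by splitting off the
cluster `E` of an edge `i`, with coefficients that grow, up to a geometric factor, like the number
`(|E| - 1)!` of cyclic orders on `E`. -/
lemma exists_cluster_expansion (hst : ∀ i, s i ≠ t i) (hc : ∀ i g, ‖c i g‖ ≤ 1) :
    ∃ φ : ι → Finset ι → ℂ,
      (∀ R, ∀ i ∈ R, balancedSum s t c R ∅ =
        ∑ E ∈ R.powerset.filter (i ∈ ·), φ i E * balancedSum s t c (R \ E) ∅) ∧
      ∀ i E, i ∈ E → ‖φ i E‖ ≤ Fintype.card G * clusterWeight E.card := by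
  obtain ⟨z, hz, hb⟩ := exists_avoiding_expansion hst hc (Fintype.card ι)
  refine ⟨fun i E => ∑ C ∈ E.powerset.filter (i ∈ ·),
    ∑ q ∈ placements G C, if IsComponent s t C (q i + s i) q then
      (∏ j ∈ C, c j (q j)) * z (C.image (q + s)) (E \ C) else 0, ?_, ?_⟩
  · intro R i hi
    rw [balancedSum_empty_eq s t c hi]
    have h1 := sum_powerset_sdiff_comm R (i ∈ ·) fun C D E =>
      ∑ q ∈ placements G C, (if IsComponent s t C (q i + s i) q then
        (∏ j ∈ C, c j (q j)) * z (C.image (q + s)) D else 0) * balancedSum s t c E ∅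
    have h2 : ∀ E ∈ R.powerset, E ∉ R.powerset.filter (i ∈ ·) →
        ∑ C ∈ E.powerset.filter (i ∈ ·), (∑ q ∈ placements G C,
          (if IsComponent s t C (q i + s i) q then
            (∏ j ∈ C, c j (q j)) * z (C.image (q + s)) (E \ C) else 0) *
              balancedSum s t c (R \ E) ∅) = 0 := by
      intro E hE hE'
      rw [Finset.sum_eq_zero]
      intro C hC
      exfalso
      rw [Finset.mem_filter, Finset.mem_powerset] at hC
      exact hE' (Finset.mem_filter.2 ⟨hE, hC.1 hC.2⟩)
    rw [← Finset.sum_subset (Finset.filter_subset _ _) h2] at h1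
    simp only [Finset.sum_mul]
    rw [← h1]
    refine Finset.sum_congr rfl fun C hC => ?_
    rw [Finset.sum_comm]
    refine Finset.sum_congr rfl fun q _ => ?_
    by_cases hP : IsComponent s t C (q i + s i) q
    · simp only [if_pos hP]
      rw [hz _ _ (Finset.card_le_univ _), Finset.mul_sum]
      exact Finset.sum_congr rfl fun D _ => by rw [mul_assoc]
    · simp only [if_neg hP, zero_mul, Finset.sum_const_zero]
  · intro i E hi
    set B : ℕ → ℝ := fun k => if k < 1 then 0 else Fintype.card G *
      (k.factorial * ((E.card - 1 - k).factorial * 3 ^ (E.card - 1 - k) * (3 / 2) ^ (1 + k)))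
      with hBdef
    have hBnn : ∀ k, 0 ≤ B k := fun k => by
      simp only [hBdef]
      split_ifs <;> positivity
    have hcard1 : (E.erase i).card = E.card - 1 := Finset.card_erase_of_mem hi
    have hEpos : 0 < E.card := Finset.card_pos.2 ⟨i, hi⟩
    have h1 : ∀ C ∈ E.powerset.filter (i ∈ ·),
        ‖∑ q ∈ placements G C, if IsComponent s t C (q i + s i) q then
          (∏ j ∈ C, c j (q j)) * z (C.image (q + s)) (E \ C) else 0‖ ≤ B (C.card - 1) := by
      intro C hC
      obtain ⟨hCE, hiC⟩ := Finset.mem_filter.1 hC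
      rw [Finset.mem_powerset] at hCE
      have hcard : (E \ C).card = E.card - C.card := Finset.card_sdiff_of_subset hCE
      by_cases h2 : 2 ≤ C.card
      · have h3 := norm_sum_component_le (s := s) hc (C := C)
          (fun q => IsComponent s t C (q i + s i) q) (fun W => z W (E \ C))
          (B := fun k => (E.card - C.card).factorial * 3 ^ (E.card - C.card) * (3 / 2) ^ k)
          ?_ ?_ ∅
        · simp only [Finset.empty_union, Finset.card_empty, zero_add] at h3
          refine h3.trans ?_
          have h4 : (((placements G C).filter fun q => IsComponent s t C (q i + s i) q).card : ℝ) ≤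
              Fintype.card G * (C.card - 1).factorial := by
            exact_mod_cast card_component_le_card_mul hiC
          have h5 : E.card - 1 - (C.card - 1) = E.card - C.card := by omega
          have h6 : 1 + (C.card - 1) = C.card := by omega
          simp only [hBdef]
          rw [if_neg (by omega), h5, h6, ← mul_assoc (Fintype.card G : ℝ)]
          refine (mul_le_mul_of_nonneg_right h4 ?_).trans_eq rfl
          positivity
        · intro k k' hk
          dsimp only
          gcongr
          norm_num
        · intro W
          have := hb W (E \ C) (Finset.card_le_univ _)
          rwa [hcard] at this
      · rw [Finset.sum_eq_zero]
        · simpa using hBnn _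
        · intro q _
          rw [if_neg]
          exact fun h => h2 (h.two_le_card hst ⟨i, hiC⟩)
    refine (norm_sum_le _ _).trans ((Finset.sum_le_sum h1).trans ?_)
    rw [sum_powerset_filter_mem hi fun C => B (C.card - 1)]
    have h3 : ∀ C ∈ (E.erase i).powerset, B ((insert i C).card - 1) = B C.card := by
      intro C hC
      rw [Finset.mem_powerset] at hC
      rw [Finset.card_insert_of_notMem fun h => Finset.notMem_erase i E (hC h)]
      rfl
    rw [Finset.sum_congr rfl h3, Finset.sum_powerset_apply_card, hcard1]
    obtain ⟨m, hm⟩ : ∃ m, E.card = m + 1 := ⟨E.card - 1, by omega⟩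
    have h4 : ∀ k ∈ Finset.range (m + 1), m.choose k • B k = if 1 ≤ k then
        Fintype.card G * (m.factorial * 3 ^ (m + 1) * (1 / 2 : ℝ) ^ (k + 1)) else 0 := by
      intro k hk
      rw [Finset.mem_range] at hk
      simp only [hBdef, hm, Nat.add_sub_cancel]
      by_cases h : 1 ≤ k
      · rw [if_neg (by omega), if_pos h, nsmul_eq_mul, mul_left_comm,
          choose_mul_half_pow (by omega)]
        ring
      · rw [if_pos (by omega), if_neg h, smul_zero]
    rw [hm, Nat.add_sub_cancel, Finset.sum_congr rfl h4, ← Finset.sum_filter, clusterWeight,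
      ← sum_Ico_half_pow, Nat.add_sub_cancel]
    refine le_of_eq ?_
    rw [← Finset.mul_sum, ← Finset.mul_sum, mul_assoc]
    congr 3
    rw [show m + 2 = (m + 1) + 1 from rfl, show 2 = 1 + 1 from rfl, ← Finset.sum_Ico_add']
    refine Finset.sum_congr ?_ fun _ _ => rfl
    ext k
    simp only [Finset.mem_filter, Finset.mem_range, Finset.mem_Ico]
    omega

end Cluster

section Symmetry

variable {ι G : Type*} [Fintype ι] [DecidableEq ι] [AddCommGroup G] [Fintype G] [DecidableEq G]

/-- The displacements and the characters of the edges in `E` add up to zero. -/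
def ZeroSum (s t : ι → G) (χ : ι → AddChar G ℂ) (E : Finset ι) : Prop :=
  ∑ i ∈ E, (t i - s i) = 0 ∧ ∀ g, ∏ i ∈ E, χ i g = 1

variable {s t : ι → G} {χ : ι → AddChar G ℂ}

omit [Fintype ι] [Fintype G] [DecidableEq G] in
lemma ZeroSum.of_sdiff {E R : Finset ι} (hER : E ⊆ R) (hE : ZeroSum s t χ E)
    (h : ZeroSum s t χ (R \ E)) : ZeroSum s t χ R := by
  refine ⟨?_, fun g => ?_⟩
  · rw [← Finset.sum_sdiff hER, h.1, hE.1, add_zero]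
  · rw [← Finset.prod_sdiff hER, h.2, hE.2, mul_one]

omit [Fintype ι] [DecidableEq ι] [Fintype G] [DecidableEq G] in
lemma Balanced.sum_eq {q : ι → G} {R : Finset ι} (h : Balanced (q + s) (q + t) R) :
    ∑ i ∈ R, (t i - s i) = 0 := by
  have h1 := congrArg Multiset.sum h
  have h2 : ∑ i ∈ R, (q i + s i) = ∑ i ∈ R, (q i + t i) := h1
  rw [Finset.sum_add_distrib, Finset.sum_add_distrib, add_right_inj] at h2
  rw [Finset.sum_sub_distrib, h2, sub_self]

omit [Fintype ι] [DecidableEq ι] [Fintype G] [DecidableEq G] in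
lemma Balanced.add_const {a b : ι → G} {R : Finset ι} (h : Balanced a b R) (g : G) :
    Balanced (fun i => a i + g) (fun i => b i + g) R := by
  have h1 := congrArg (Multiset.map (· + g)) h
  rw [Multiset.map_map, Multiset.map_map] at h1
  exact h1

/-- Translating all vertices multiplies the weight by a character. -/
lemma balancedSum_translate (R : Finset ι) (g : G) :
    balancedSum s t (fun i => χ i) R ∅ =
      (∏ i ∈ R, χ i g) * balancedSum s t (fun i => χ i) R ∅ := by
  classical
  conv_lhs => rw [balancedSum]
  rw [balancedSum, Finset.mul_sum]
  refine Finset.sum_nbij' (fun q i => if i ∈ R then q i - g else 0)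
    (fun q i => if i ∈ R then q i + g else 0) ?_ ?_ ?_ ?_ ?_
  · intro q _
    rw [mem_placements]
    intro i hi
    simp [hi]
  · intro q _
    rw [mem_placements]
    intro i hi
    simp [hi]
  · intro q hq
    rw [mem_placements] at hq
    ext i
    by_cases hi : i ∈ R
    · simp [hi]
    · simp [hi, hq i hi]
  · intro q hq
    rw [mem_placements] at hq
    ext i
    by_cases hi : i ∈ R
    · simp [hi]
    · simp [hi, hq i hi]
  · intro q _
    have hiff : Balanced (q + s) (q + t) R ↔
        Balanced ((fun i => if i ∈ R then q i - g else 0) + s)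
          ((fun i => if i ∈ R then q i - g else 0) + t) R := by
      constructor
      · intro h
        refine (Balanced.congr ?_ ?_).1 (h.add_const (-g)) <;>
        · intro i hi
          simp only [Pi.add_apply, if_pos hi]
          abel
      · intro h
        refine (Balanced.congr ?_ ?_).1 (h.add_const g) <;>
        · intro i hi
          simp only [Pi.add_apply, if_pos hi]
          abel
    rw [mul_ite, mul_zero]
    refine if_congr (and_congr hiff (by simp)) ?_ rfl
    rw [← Finset.prod_mul_distrib]
    refine Finset.prod_congr rfl fun i hi => ?_
    simp only [if_pos hi]
    rw [← AddChar.map_add_eq_mul, add_sub_cancel]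

lemma balancedSum_eq_zero {R : Finset ι} (h : ¬ ZeroSum s t χ R) :
    balancedSum s t (fun i => χ i) R ∅ = 0 := by
  classical
  by_contra hne
  refine h ⟨?_, fun g => ?_⟩
  · rw [balancedSum] at hne
    obtain ⟨q, -, hq⟩ := Finset.exists_ne_zero_of_sum_ne_zero hne
    by_contra hs
    refine hq ?_
    rw [if_neg]
    exact fun h => hs h.1.sum_eq
  · have := balancedSum_translate (s := s) (t := t) (χ := χ) R g
    exact (mul_eq_right₀ hne).1 this.symm

open scoped Classical in
/-- The cluster expansion for weights given by characters: by translation invariance only the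
clusters with zero sum contribute. -/
lemma exists_zeroSum_expansion (hst : ∀ i, s i ≠ t i) :
    ∃ φ : ι → Finset ι → ℂ,
      (∀ R, ∀ i ∈ R, balancedSum s t (fun i => χ i) R ∅ =
        ∑ E ∈ R.powerset.filter (i ∈ ·), φ i E * balancedSum s t (fun i => χ i) (R \ E) ∅) ∧
      ∀ i E, i ∈ E → ‖φ i E‖ ≤
        if ZeroSum s t χ E then Fintype.card G * clusterWeight E.card else 0 := by
  obtain ⟨φ, h1, h2⟩ := exists_cluster_expansion (c := fun i => χ i) hst
    fun i g => (AddChar.norm_apply (χ i) g).le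
  refine ⟨φ, h1, fun i E hi => ?_⟩
  split_ifs with hE
  · exact h2 i E hi
  · suffices h : ∀ k, ∀ E : Finset ι, E.card ≤ k → i ∈ E → ¬ ZeroSum s t χ E → φ i E = 0 by
      rw [h _ E le_rfl hi hE, norm_zero]
    intro k
    induction k with
    | zero =>
      intro E hE hi
      rw [Nat.le_zero, Finset.card_eq_zero] at hE
      simp [hE] at hi
    | succ k ih =>
      intro E hcard hi hE
      have h3 := h1 E i hi
      rw [balancedSum_eq_zero hE, Finset.sum_eq_single E] at h3
      · rw [Finset.sdiff_self, balancedSum_empty, mul_one] at h3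
        exact h3.symm
      · intro D hD hDE
        rw [Finset.mem_filter, Finset.mem_powerset] at hD
        by_cases hDz : ZeroSum s t χ D
        · rw [balancedSum_eq_zero fun h => hE (ZeroSum.of_sdiff hD.1 hDz h), mul_zero]
        · have hlt : D.card < E.card := Finset.card_lt_card (hD.1.ssubset_of_ne hDE)
          rw [ih D (by omega) hD.2 hDz, zero_mul]
      · intro hnot
        exact absurd (Finset.mem_filter.2 ⟨Finset.mem_powerset_self E, hi⟩) hnot

end Symmetry

section Partition

variable {ι : Type*} [DecidableEq ι]

open scoped Classical in
/-- The partitions of the finite set `R`, as lists of blocks; the first argument bounds the number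
of blocks. -/
noncomputable def blockLists : ℕ → Finset ι → Multiset (List (Finset ι))
  | 0, _ => {[]}
  | k + 1, R => if h : R.Nonempty then
      (R.powerset.filter (h.choose ∈ ·)).val.bind fun E => (blockLists k (R \ E)).map (E :: ·)
    else {[]}

/-- The sum over all partitions of `R` of the products of the weights `W E` of the blocks. -/
noncomputable def blockSum (W : Finset ι → ℝ) (k : ℕ) (R : Finset ι) : ℝ :=
  ((blockLists k R).map fun P => (P.map W).prod).sum

lemma blockSum_empty (W : Finset ι → ℝ) (k : ℕ) : blockSum W k ∅ = 1 := by
  cases k <;> simp [blockSum, blockLists]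

lemma blockSum_succ (W : Finset ι → ℝ) (k : ℕ) {R : Finset ι} (h : R.Nonempty) :
    ∃ i ∈ R, blockSum W (k + 1) R =
      ∑ E ∈ R.powerset.filter (i ∈ ·), W E * blockSum W k (R \ E) := by
  classical
  refine ⟨h.choose, h.choose_spec, ?_⟩
  rw [blockSum, blockLists, dif_pos h, Multiset.map_bind, Multiset.sum_bind]
  simp only [Multiset.map_map, Function.comp_def, List.map_cons, List.prod_cons]
  simp only [Multiset.sum_map_mul_left]
  refine Finset.sum_congr ?_ fun _ _ => rfl
  congr

lemma blockSum_nonneg {W : Finset ι → ℝ} (hW : ∀ E : Finset ι, E.Nonempty → 0 ≤ W E) (k : ℕ) :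
    ∀ R : Finset ι, 0 ≤ blockSum W k R := by
  induction k with
  | zero => intro R; simp [blockSum, blockLists]
  | succ k ih =>
    intro R
    by_cases hR : R.Nonempty
    · obtain ⟨i, _, h⟩ := blockSum_succ W k hR
      rw [h]
      refine Finset.sum_nonneg fun E hE => mul_nonneg (hW E ⟨i, (Finset.mem_filter.1 hE).2⟩) (ih _)
    · rw [Finset.not_nonempty_iff_eq_empty] at hR
      simp [hR, blockSum_empty]

lemma blockLists_spec (k : ℕ) : ∀ R : Finset ι, R.card ≤ k → ∀ P ∈ blockLists k R,
    (∀ E ∈ P, E.Nonempty ∧ E ⊆ R) ∧ P.Pairwise Disjoint ∧ (P.map Finset.card).sum = R.card := by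
  induction k with
  | zero =>
    intro R hR P hP
    rw [Nat.le_zero] at hR
    simp [blockLists] at hP
    simp [hP, hR]
  | succ k ih =>
    intro R hR P hP
    by_cases h : R.Nonempty
    · rw [blockLists, dif_pos h, Multiset.mem_bind] at hP
      obtain ⟨E, hE, hP⟩ := hP
      obtain ⟨P', hP', rfl⟩ := Multiset.mem_map.1 hP
      rw [Finset.mem_val, Finset.mem_filter, Finset.mem_powerset] at hE
      have hcard : (R \ E).card = R.card - E.card := Finset.card_sdiff_of_subset hE.1
      have hpos : 0 < E.card := Finset.card_pos.2 ⟨_, hE.2⟩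
      have hle := Finset.card_le_card hE.1
      obtain ⟨h1, h2, h3⟩ := ih (R \ E) (by omega) P' hP'
      refine ⟨?_, ?_, ?_⟩
      · intro D hD
        rcases List.mem_cons.1 hD with rfl | hD
        · exact ⟨⟨_, hE.2⟩, hE.1⟩
        · exact ⟨(h1 D hD).1, (h1 D hD).2.trans Finset.sdiff_subset⟩
      · rw [List.pairwise_cons]
        exact ⟨fun D hD => (Finset.disjoint_of_subset_left (h1 D hD).2
          Finset.sdiff_disjoint).symm, h2⟩
      · rw [List.map_cons, List.sum_cons, h3, hcard]
        omega
    · rw [Finset.not_nonempty_iff_eq_empty] at h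
      subst h
      simp [blockLists] at hP
      simp [hP]

/-- The sums over partitions in which a block of `k` elements has weight `u k` are bounded
geometrically. -/
lemma blockSum_le_pow {u : ℕ → ℝ} {κ : ℝ} (hu : ∀ k, k ≠ 0 → 0 ≤ u k) {N₀ : ℕ}
    (h : ∀ N, N + 1 ≤ N₀ →
      ∑ k ∈ Finset.range (N + 1), N.choose k * (u (k + 1) * κ ^ (N - k)) ≤ κ ^ (N + 1)) (k : ℕ) :
    ∀ R : Finset ι, R.card ≤ k → R.card ≤ N₀ → blockSum (fun E => u E.card) k R ≤ κ ^ R.card := by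
  induction k with
  | zero =>
    intro R hR _
    rw [Nat.le_zero, Finset.card_eq_zero] at hR
    simp [hR, blockSum_empty]
  | succ k ih =>
    intro R hR hN₀
    by_cases hne : R.Nonempty
    · obtain ⟨i, hi, heq⟩ := blockSum_succ (fun E : Finset ι => u E.card) k hne
      rw [heq]
      have hle : ∀ E ∈ R.powerset.filter (i ∈ ·),
          u E.card * blockSum (fun E : Finset ι => u E.card) k (R \ E) ≤
            u E.card * κ ^ (R.card - E.card) := by
        intro E hE
        rw [Finset.mem_filter, Finset.mem_powerset] at hE
        have hcard : (R \ E).card = R.card - E.card := Finset.card_sdiff_of_subset hE.1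
        have hpos : 0 < E.card := Finset.card_pos.2 ⟨_, hE.2⟩
        have := ih (R \ E) (by omega) (by omega)
        rw [hcard] at this
        exact mul_le_mul_of_nonneg_left this (hu _ hpos.ne')
      refine (Finset.sum_le_sum hle).trans ?_
      rw [sum_powerset_filter_mem hi fun E => u E.card * κ ^ (R.card - E.card)]
      obtain ⟨N, hN⟩ : ∃ N, R.card = N + 1 := ⟨R.card - 1, by
        have := hne.card_pos
        omega⟩
      have h3 : ∀ C ∈ (R.erase i).powerset, u (insert i C).card *
          κ ^ (R.card - (insert i C).card) = u (C.card + 1) * κ ^ (N - C.card) := by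
        intro C hC
        rw [Finset.mem_powerset] at hC
        rw [Finset.card_insert_of_notMem fun h => Finset.notMem_erase i R (hC h), hN,
          Nat.add_sub_add_right]
      rw [Finset.sum_congr rfl h3,
        Finset.sum_powerset_apply_card (fun k => u (k + 1) * κ ^ (N - k)),
        Finset.card_erase_of_mem hi, hN, Nat.add_sub_cancel]
      simp only [nsmul_eq_mul]
      exact h N (by omega)
    · rw [Finset.not_nonempty_iff_eq_empty] at hne
      simp [hne, blockSum_empty]

variable {G : Type*} [Fintype ι] [AddCommGroup G] [Fintype G] [DecidableEq G]
  {s t : ι → G} {χ : ι → AddChar G ℂ}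

open scoped Classical in
/-- Iterating the cluster expansion. -/
lemma norm_balancedSum_le (hst : ∀ i, s i ≠ t i) (k : ℕ) : ∀ R : Finset ι, R.card ≤ k →
    ‖balancedSum s t (fun i => χ i) R ∅‖ ≤ blockSum (fun E =>
      if ZeroSum s t χ E then Fintype.card G * clusterWeight E.card else 0) k R := by
  obtain ⟨φ, h1, h2⟩ := exists_zeroSum_expansion (χ := χ) hst
  induction k with
  | zero =>
    intro R hR
    rw [Nat.le_zero, Finset.card_eq_zero] at hR
    simp [hR, blockSum_empty, balancedSum_empty]
  | succ k ih =>
    intro R hR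
    by_cases hne : R.Nonempty
    · obtain ⟨i, hi, heq⟩ := blockSum_succ (fun E : Finset ι =>
        if ZeroSum s t χ E then Fintype.card G * clusterWeight E.card else 0) k hne
      rw [heq, h1 R i hi]
      refine (norm_sum_le _ _).trans ?_
      have hfil : ∀ (inst : DecidablePred (i ∈ · : Finset ι → Prop)),
        @Finset.filter _ (i ∈ ·) inst R.powerset = R.powerset.filter (i ∈ ·) := by
        intro inst; congr
      rw [hfil]
      refine Finset.sum_le_sum fun E hE => ?_
      rw [Finset.mem_filter, Finset.mem_powerset] at hE
      rw [norm_mul]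
      have hcard : (R \ E).card = R.card - E.card := Finset.card_sdiff_of_subset hE.1
      have hpos : 0 < E.card := Finset.card_pos.2 ⟨_, hE.2⟩
      refine mul_le_mul (h2 i E hE.2) (ih _ (by omega)) (norm_nonneg _) ?_
      exact (norm_nonneg _).trans (h2 i E hE.2)
    · rw [Finset.not_nonempty_iff_eq_empty] at hne
      simp [hne, blockSum_empty, balancedSum_empty]

end Partition

/-! ### Path expansion of the iterates, and counting paths under zero-sum constraints -/

section PathCount

variable {ι Λ A : Type*} [Fintype ι] [DecidableEq ι] [Fintype Λ] [AddCommGroup A]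

open scoped Classical in
/-- If the increments `e l i` determine `l i` from the entries of smaller rank, then every block
of a partition whose increments add up to zero removes one degree of freedom: its entry of maximal
rank is determined by the others. -/
lemma card_zeroSum_le {r : ι → ℕ} (hr : Function.Injective r) (e : (ι → Λ) → ι → A)
    (h1 : ∀ l l' i, (∀ k, r k ≤ r i → l k = l' k) → e l i = e l' i)
    (h2 : ∀ l l' i, (∀ k, r k < r i → l k = l' k) → e l i = e l' i → l i = l' i)
    (P : List (Finset ι)) (hne : ∀ E ∈ P, E.Nonempty) (hd : P.Pairwise Disjoint) :
    (Finset.univ.filter fun l : ι → Λ => ∀ E ∈ P, ∑ i ∈ E, e l i = 0).card ≤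
      Fintype.card Λ ^ (Fintype.card ι - P.length) := by
  by_cases hP : P = []
  · subst hP
    refine (Finset.card_le_univ _).trans ?_
    simp
  obtain ⟨E₀, hE₀⟩ := List.exists_mem_of_ne_nil P hP
  have hι : Nonempty ι := ⟨(hne E₀ hE₀).choose⟩
  choose! top htop using fun E hE => Finset.exists_max_image E r (hne E hE)
  set M : Finset ι := (P.map top).toFinset with hM
  have hMcard : M.card = P.length := by
    rw [hM, List.toFinset_card_of_nodup, List.length_map]
    rw [List.Nodup, List.pairwise_map]
    refine List.Pairwise.imp_of_mem ?_ hd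
    intro E E' hE hE' hdis heq
    have hm := (htop E hE).1
    rw [heq] at hm
    exact Finset.disjoint_left.1 hdis hm (htop E' hE').1
  calc _ ≤ (Finset.univ : Finset ({i // i ∉ M} → Λ)).card := by
        refine Finset.card_le_card_of_injOn (fun l i => l i) (fun _ _ => Finset.mem_univ _) ?_
        intro l hl l' hl' hll
        rw [Finset.mem_coe, Finset.mem_filter] at hl hl'
        have hout : ∀ i, i ∉ M → l i = l' i := fun i hi => congrFun hll ⟨i, hi⟩
        suffices h : ∀ N i, r i < N → l i = l' i from funext fun i => h _ i (Nat.lt_succ_self _)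
        intro N
        induction N with
        | zero => intro i hi; omega
        | succ N ih =>
          intro i hi
          by_cases hiM : i ∈ M
          · rw [hM, List.mem_toFinset, List.mem_map] at hiM
            obtain ⟨E, hE, rfl⟩ := hiM
            obtain ⟨hm, hmax⟩ := htop E hE
            have hlt : ∀ k, r k < r (top E) → l k = l' k := fun k hk => ih k (by omega)
            refine h2 l l' _ hlt ?_
            have hs := (hl.2 E hE).trans (hl'.2 E hE).symm
            rw [← Finset.add_sum_erase _ _ hm, ← Finset.add_sum_erase _ _ hm] at hs
            have hrest : ∑ k ∈ E.erase (top E), e l k = ∑ k ∈ E.erase (top E), e l' k := by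
              refine Finset.sum_congr rfl fun k hk => h1 l l' k fun j hj => hlt j ?_
              rw [Finset.mem_erase] at hk
              have : r k ≠ r (top E) := fun h => hk.1 (hr h)
              have := hmax k hk.2
              omega
            rw [hrest] at hs
            exact add_right_cancel hs
          · exact hout i hiM
    _ = Fintype.card Λ ^ (Fintype.card ι - P.length) := by
        rw [Finset.card_univ, Fintype.card_fun, Fintype.card_subtype_compl, Fintype.card_coe, hMcard]

end PathCount

section Iterate

variable {A : Type*}

/-- The iterates `σ, H σ, H² σ, …`, where the sums run over `Λ` and the first index of the last
application of `H` is arbitrary. -/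
noncomputable def iterate (H : A → A → ℂ) (Λ : Finset A) (σ : A → ℂ) : ℕ → A → ℂ
  | 0 => σ
  | m + 1 => fun ρ => ∑ l : Λ, H ρ l * iterate H Λ σ m l

/-- The vertices `ρ, f 0, f 1, …` of a path. -/
def pathVertex {Λ : Finset A} (ρ : A) {m : ℕ} (f : Fin m → Λ) : Fin (m + 1) → A :=
  Fin.cons ρ fun j => (f j : A)

lemma iterate_eq_sum_paths (H : A → A → ℂ) (Λ : Finset A) (σ : A → ℂ) (m : ℕ) (ρ : A) :
    iterate H Λ σ m ρ = ∑ f : Fin m → Λ,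
      (∏ j : Fin m, H (pathVertex ρ f j.castSucc) (pathVertex ρ f j.succ)) *
        σ (pathVertex ρ f (Fin.last m)) := by
  induction m generalizing ρ with
  | zero => simp [iterate, pathVertex]
  | succ m ih =>
    rw [iterate, ← (Fin.consEquiv fun _ : Fin (m + 1) => (Λ : Type _)).sum_comp,
      Fintype.sum_prod_type]
    refine Finset.sum_congr rfl fun l _ => ?_
    rw [ih, Finset.mul_sum]
    refine Finset.sum_congr rfl fun f _ => ?_
    rw [Fin.prod_univ_succ, ← mul_assoc]
    have hv : ∀ j : Fin (m + 1), pathVertex ρ (Fin.cons l f : Fin (m + 1) → Λ) j.succ =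
        pathVertex (l : A) f j := by
      intro j
      cases j using Fin.cases <;> simp [pathVertex]
    have e : (Fin.consEquiv fun _ : Fin (m + 1) => (Λ : Type _)) (l, f) = Fin.cons l f := rfl
    rw [e]
    congr 1
    · congr 1
      · refine Finset.prod_congr rfl fun j _ => ?_
        rw [hv, ← Fin.succ_castSucc, hv]
    · rw [← Fin.succ_last, hv]

end Iterate

/-! ### Moments of Steinhaus variables -/

section Steinhaus

variable {Ω : Type*} [MeasurableSpace Ω] {P : Measure Ω}

lemma integral_torusUniform_pow (α β : ℕ) :
    ∫ z, (starRingEnd ℂ z) ^ α * z ^ β ∂torusUniform = if α = β then 1 else 0 := by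
  have hmeas : Measurable fun t : ℝ => Complex.exp (2 * Real.pi * t * Complex.I) := by fun_prop
  rw [torusUniform, integral_map hmeas.aemeasurable
    (by fun_prop : Continuous fun z : ℂ => (starRingEnd ℂ z) ^ α * z ^ β).aestronglyMeasurable]
  have h1 : ∀ t : ℝ, (starRingEnd ℂ (Complex.exp (2 * Real.pi * t * Complex.I))) ^ α *
      Complex.exp (2 * Real.pi * t * Complex.I) ^ β =
      Complex.exp ((2 * Real.pi * Complex.I * ((β : ℤ) - α : ℤ)) * t) := by
    intro t
    rw [← Complex.exp_conj, ← Complex.exp_nat_mul, ← Complex.exp_nat_mul, ← Complex.exp_add]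
    congr 1
    simp only [map_mul, Complex.conj_ofReal, Complex.conj_I, map_ofNat]
    push_cast
    ring
  simp only [h1]
  rw [← intervalIntegral.integral_of_le zero_le_one]
  by_cases h : α = β
  · simp [h]
  · rw [if_neg h]
    have hne : (2 * Real.pi * Complex.I * ((β : ℤ) - α : ℤ) : ℂ) ≠ 0 := by
      refine mul_ne_zero Complex.two_pi_I_ne_zero ?_
      rw [Int.cast_ne_zero]
      omega
    rw [integral_exp_mul_complex hne]
    have : Complex.exp (2 * Real.pi * Complex.I * ((β : ℤ) - α : ℤ) * (1 : ℝ)) = 1 := by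
      rw [Complex.ofReal_one, mul_one, mul_comm]
      exact Complex.exp_int_mul_two_pi_mul_I _
    rw [this]
    simp

lemma steinhaus_ae_norm_eq_one {σ : Type*} [Countable σ] {e : σ → Ω → ℂ}
    (he : IsSteinhausSequence P e) : ∀ᵐ ω ∂P, ∀ q, ‖e q ω‖ = 1 := by
  rw [ae_all_iff]
  intro q
  have h1 : ∀ᵐ z ∂torusUniform, ‖z‖ = 1 := by
    rw [torusUniform, ae_map_iff (by fun_prop) (measurableSet_eq_fun (by fun_prop) (by fun_prop))]
    refine Filter.Eventually.of_forall fun t => ?_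
    have : (2 * Real.pi * t * Complex.I : ℂ) = ((2 * Real.pi * t : ℝ) : ℂ) * Complex.I := by
      push_cast; ring
    rw [this, Complex.norm_exp_ofReal_mul_I]
  have h2 := (he.1 q).map_eq
  rw [← h2] at h1
  exact ae_of_ae_map (he.1 q).aemeasurable h1

variable {σ ι : Type*} [Fintype σ] [DecidableEq σ] [Fintype ι]

open scoped Classical in
/-- A monomial in the Steinhaus variables has mean one if it is balanced, and mean zero otherwise. -/
lemma steinhaus_integral_prod {e : σ → Ω → ℂ}
    (he : IsSteinhausSequence P e) (a b : ι → σ) :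
    ∫ ω, ∏ i, (starRingEnd ℂ (e (a i) ω) * e (b i) ω) ∂P =
      if Balanced a b Finset.univ then 1 else 0 := by
  have h1 : ∀ ω, ∏ i, (starRingEnd ℂ (e (a i) ω) * e (b i) ω) =
      ∏ q, ((starRingEnd ℂ (e q ω)) ^ (Finset.univ.filter fun i => a i = q).card *
        (e q ω) ^ (Finset.univ.filter fun i => b i = q).card) := by
    intro ω
    rw [Finset.prod_mul_distrib, Finset.prod_mul_distrib]
    congr 1
    · rw [← Finset.prod_fiberwise' Finset.univ a fun q => starRingEnd ℂ (e q ω)]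
      simp only [Finset.prod_const]
    · rw [← Finset.prod_fiberwise' Finset.univ b fun q => e q ω]
      simp only [Finset.prod_const]
  simp only [h1]
  rw [he.2.integral_fun_prod_comp (f := fun q z => (starRingEnd ℂ z) ^
    (Finset.univ.filter fun i => a i = q).card * z ^ (Finset.univ.filter fun i => b i = q).card)
    (fun q => (he.1 q).aemeasurable) (fun q => Continuous.aestronglyMeasurable (by fun_prop))]
  have h2 : ∀ q, ∫ ω, (starRingEnd ℂ (e q ω)) ^ (Finset.univ.filter fun i => a i = q).card *
      (e q ω) ^ (Finset.univ.filter fun i => b i = q).card ∂P =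
      if (Finset.univ.filter fun i => a i = q).card = (Finset.univ.filter fun i => b i = q).card
        then 1 else 0 := by
    intro q
    rw [← integral_torusUniform_pow]
    exact (he.1 q).integral_comp (f := fun z => (starRingEnd ℂ z) ^
      (Finset.univ.filter fun i => a i = q).card * z ^ (Finset.univ.filter fun i => b i = q).card)
      (Continuous.aestronglyMeasurable (by fun_prop))
  simp only [h2]
  rw [Finset.prod_ite_zero]
  simp only [Finset.prod_const_one]
  refine if_congr ?_ rfl rfl
  unfold Balanced
  rw [Multiset.ext]
  simp only [Multiset.count_map, Finset.mem_univ, true_imp_iff]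
  refine forall_congr' fun q => ?_
  have h3 : ∀ c : ι → σ, (Multiset.filter (fun i => q = c i) Finset.univ.val).card =
      (Finset.univ.filter fun i => c i = q).card := by
    intro c
    rw [Finset.card_def, Finset.filter_val]
    simp only [eq_comm]
  rw [h3, h3]

omit [DecidableEq σ] in
lemma steinhaus_integrable_prod [IsProbabilityMeasure P] {e : σ → Ω → ℂ}
    (he : IsSteinhausSequence P e) (a b : ι → σ) :
    Integrable (fun ω => ∏ i, (starRingEnd ℂ (e (a i) ω) * e (b i) ω)) P := by
  have hm : ∀ q, AEMeasurable (e q) P := fun q => (he.1 q).aemeasurable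
  refine Integrable.of_bound ?_ 1 ?_
  · refine AEMeasurable.aestronglyMeasurable ?_
    refine Finset.aemeasurable_fun_prod _ fun i _ => ?_
    exact ((Complex.continuous_conj.measurable.comp_aemeasurable (hm (a i)))).mul (hm (b i))
  · filter_upwards [steinhaus_ae_norm_eq_one he] with ω hω
    rw [norm_prod]
    refine Finset.prod_le_one (fun _ _ => norm_nonneg _) fun i _ => ?_
    rw [norm_mul, RCLike.norm_conj, hω, hω, one_mul]

end Steinhaus

/-! ### Products of entries of the Gram matrix -/

section Moment

variable {n : ℕ} [NeZero n]

/-- The off-diagonal entries of the Gram matrix of the time-frequency shifts of the window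
`n ^ (-1/2) ε`. -/
noncomputable def offGram (ε : ZMod n → ℂ) (l l' : ZMod n × ZMod n) : ℂ :=
  if l.1 = l'.1 then 0 else (1 / n : ℂ) * ∑ q, ZMod.stdAddChar ((l'.2 - l.2) * q) *
    (starRingEnd ℂ (ε (q + l.1)) * ε (q + l'.1))

lemma conj_offGram (ε : ZMod n → ℂ) (l l' : ZMod n × ZMod n) :
    starRingEnd ℂ (offGram ε l l') = offGram ε l' l := by
  unfold offGram
  by_cases h : l.1 = l'.1
  · rw [if_pos h, if_pos h.symm, map_zero]
  · rw [if_neg h, if_neg (Ne.symm h), map_mul, map_sum]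
    congr 1
    · simp
    · refine Finset.sum_congr rfl fun q _ => ?_
      rw [RingHom.map_mul, RingHom.map_mul, Complex.conj_conj, ← AddChar.map_neg_eq_conj, ← neg_mul, neg_sub]
      ring

variable {ι : Type*} [Fintype ι] [DecidableEq ι]

/-- The character `q ↦ e^{2πi(ℓ' - ℓ)q/n}` of the edge `i`. -/
noncomputable def edgeChar (u v : ι → ZMod n × ZMod n) (i : ι) : AddChar (ZMod n) ℂ :=
  ZMod.stdAddChar.mulShift ((v i).2 - (u i).2)

lemma prod_offGram (ε : ZMod n → ℂ) (u v : ι → ZMod n × ZMod n) (h : ∀ i, (u i).1 ≠ (v i).1) :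
    ∏ i, offGram ε (u i) (v i) = ∑ q : ι → ZMod n, ((1 / n : ℂ) ^ Fintype.card ι *
      ∏ i, edgeChar u v i (q i)) *
      ∏ i, (starRingEnd ℂ (ε (q i + (u i).1)) * ε (q i + (v i).1)) := by
  classical
  simp only [offGram, if_neg (h _)]
  rw [Finset.prod_mul_distrib, Finset.prod_const, Finset.card_univ, Fintype.prod_sum,
    Finset.mul_sum]
  refine Finset.sum_congr rfl fun q _ => ?_
  rw [Finset.prod_mul_distrib, mul_assoc]
  simp only [edgeChar, AddChar.mulShift_apply]

omit [Fintype ι] [DecidableEq ι] in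
lemma zeroSum_edgeChar_iff (u v : ι → ZMod n × ZMod n) (E : Finset ι) :
    ZeroSum (fun i => (u i).1) (fun i => (v i).1) (edgeChar u v) E ↔
      ∑ i ∈ E, (v i - u i) = 0 := by
  have h : ∀ g, ∏ i ∈ E, edgeChar u v i g = ZMod.stdAddChar ((∑ i ∈ E, (v i - u i)).2 * g) := by
    intro g
    classical
    induction E using Finset.induction_on with
    | empty => simp
    | insert i E hi ih =>
      rw [Finset.prod_insert hi, Finset.sum_insert hi, ih, edgeChar, AddChar.mulShift_apply,
        Prod.snd_add, add_mul, AddChar.map_add_eq_mul]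
      rfl
  unfold ZeroSum
  simp only [h]
  rw [Prod.ext_iff, Prod.fst_sum]
  refine and_congr Iff.rfl ⟨fun h => ?_, fun h g => ?_⟩
  · have h1 := h 1
    rw [mul_one, ← AddChar.map_zero_eq_one (ZMod.stdAddChar (N := n))] at h1
    exact ZMod.injective_stdAddChar h1
  · rw [h, Prod.snd_zero, zero_mul, AddChar.map_zero_eq_one]

variable {Ω : Type*} [MeasurableSpace Ω] {P : Measure Ω} [IsProbabilityMeasure P]
  {e : ZMod n → Ω → ℂ}

lemma integrable_prod_offGram (he : IsSteinhausSequence P e) (u v : ι → ZMod n × ZMod n) :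
    Integrable (fun ω => ∏ i, offGram (fun q => e q ω) (u i) (v i)) P := by
  classical
  by_cases h : ∀ i, (u i).1 ≠ (v i).1
  · simp only [prod_offGram _ u v h]
    refine integrable_finsetSum _ fun q _ => Integrable.const_mul ?_ _
    exact steinhaus_integrable_prod he _ _
  · push Not at h
    obtain ⟨i, hi⟩ := h
    have : ∀ ω, ∏ i, offGram (fun q => e q ω) (u i) (v i) = 0 := fun ω =>
      Finset.prod_eq_zero (Finset.mem_univ i) (by rw [offGram, if_pos hi])
    simp only [this]
    exact integrable_zero _ _ _

open scoped Classical in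
/-- The expectation of a product of entries of the Gram matrix, bounded by a sum over the partitions
of the factors into blocks with zero sum. -/
lemma norm_integral_prod_offGram_le (he : IsSteinhausSequence P e) (u v : ι → ZMod n × ZMod n) :
    ‖∫ ω, ∏ i, offGram (fun q => e q ω) (u i) (v i) ∂P‖ ≤ (1 / n : ℝ) ^ Fintype.card ι *
      blockSum (fun E => if ∑ i ∈ E, (v i - u i) = 0 then n * clusterWeight E.card else 0)
        (Fintype.card ι) Finset.univ := by
  by_cases h : ∀ i, (u i).1 ≠ (v i).1
  · have h1 : ∫ ω, ∏ i, offGram (fun q => e q ω) (u i) (v i) ∂P = (1 / n : ℂ) ^ Fintype.card ι *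
        balancedSum (fun i => (u i).1) (fun i => (v i).1) (fun i => edgeChar u v i)
          Finset.univ ∅ := by
      simp only [prod_offGram _ u v h]
      rw [integral_finsetSum]
      · have hpl : placements (ZMod n) (Finset.univ : Finset ι) = Finset.univ := by
          ext q
          simp [mem_placements]
        rw [balancedSum, hpl, Finset.mul_sum]
        refine Finset.sum_congr rfl fun q _ => ?_
        rw [integral_const_mul, steinhaus_integral_prod he]
        simp only [Finset.notMem_empty, not_false_eq_true, implies_true, and_true, mul_ite,
          mul_one, mul_zero]
        rfl
      · intro q _
        exact (steinhaus_integrable_prod he _ _).const_mul _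
    have h2 := norm_balancedSum_le (χ := edgeChar u v) h (Fintype.card ι) Finset.univ
      (by rw [Finset.card_univ])
    rw [h1, norm_mul, norm_pow, norm_div, norm_one, Complex.norm_natCast]
    refine mul_le_mul_of_nonneg_left (h2.trans_eq ?_) (by positivity)
    congr 1
    ext E
    rw [ZMod.card]
    exact if_congr (zeroSum_edgeChar_iff u v E) rfl rfl
  · push Not at h
    obtain ⟨i, hi⟩ := h
    have : ∀ ω, ∏ i, offGram (fun q => e q ω) (u i) (v i) = 0 := fun ω =>
      Finset.prod_eq_zero (Finset.mem_univ i) (by rw [offGram, if_pos hi])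
    simp only [this, integral_zero, norm_zero]
    refine mul_nonneg (by positivity) (blockSum_nonneg (fun E hE => ?_) _ _)
    split_ifs
    · exact mul_nonneg (Nat.cast_nonneg _) (clusterWeight_nonneg hE.card_pos.ne')
    · exact le_rfl

end Moment

section PathIncrement

variable {A : Type*} {Λ : Finset A} {κ : Type*} {m : ℕ}

lemma pathVertex_succ (ρ : A) (f : Fin m → Λ) (j : Fin m) : pathVertex ρ f j.succ = f j := by
  simp [pathVertex]

lemma pathVertex_castSucc_congr (ρ : A) {f f' : Fin m → Λ} {j : Fin m}
    (h : ∀ k < j, f k = f' k) : pathVertex ρ f j.castSucc = pathVertex ρ f' j.castSucc := by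
  rcases Fin.eq_zero_or_eq_succ j.castSucc with h0 | ⟨k, hk⟩
  · rw [h0]
    simp [pathVertex]
  · rw [hk, pathVertex_succ, pathVertex_succ, h]
    have := congrArg Fin.val hk
    simp only [Fin.val_castSucc, Fin.val_succ] at this
    rw [Fin.lt_def]
    omega

/-- The first index of the `j`-th factor in the `p`-th path; the paths in the complex conjugate
factors are traversed backwards. -/
def pathSrc (ρ : A) (l : (κ × Bool) × Fin m → Λ) (i : (κ × Bool) × Fin m) : A :=
  if i.1.2 then pathVertex ρ (fun j => l (i.1, j)) i.2.succ
  else pathVertex ρ (fun j => l (i.1, j)) i.2.castSucc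

/-- The second index of the `j`-th factor in the `p`-th path. -/
def pathTgt (ρ : A) (l : (κ × Bool) × Fin m → Λ) (i : (κ × Bool) × Fin m) : A :=
  if i.1.2 then pathVertex ρ (fun j => l (i.1, j)) i.2.castSucc
  else pathVertex ρ (fun j => l (i.1, j)) i.2.succ

open scoped Classical in
/-- The number of families of paths for which the increments add up to zero on each block. The
factors are ordered along each path, so that an increment determines the next vertex from the
previous one. -/
lemma card_pathIncrement_le [AddCommGroup A] [Fintype κ] (ρ : A)
    (P : List (Finset ((κ × Bool) × Fin m))) (hne : ∀ E ∈ P, E.Nonempty)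
    (hd : P.Pairwise Disjoint) :
    (Finset.univ.filter fun l : (κ × Bool) × Fin m → Λ =>
      ∀ E ∈ P, ∑ i ∈ E, (pathTgt ρ l i - pathSrc ρ l i) = 0).card ≤
      Λ.card ^ (Fintype.card ((κ × Bool) × Fin m) - P.length) := by
  have h := card_zeroSum_le (Λ := Λ)
    (r := fun i : (κ × Bool) × Fin m => (finProdFinEquiv (Fintype.equivFin (κ × Bool) i.1, i.2) : ℕ))
    ?_ (fun l i => pathTgt ρ l i - pathSrc ρ l i) ?_ ?_ P hne hd
  · rw [Fintype.card_coe] at h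
    convert h
  · intro i i' hii
    have h1 := finProdFinEquiv.injective (Fin.ext hii)
    rw [Prod.mk.injEq, EmbeddingLike.apply_eq_iff_eq] at h1
    exact Prod.ext h1.1 h1.2
  · rintro l l' ⟨p, j⟩ hl
    have hlt : ∀ k ≤ j, l (p, k) = l' (p, k) := by
      intro k hk
      refine hl (p, k) ?_
      simp only [finProdFinEquiv_apply_val]
      rw [Fin.le_def] at hk
      omega
    have h1 : pathVertex ρ (fun j => l (p, j)) j.castSucc =
        pathVertex ρ (fun j => l' (p, j)) j.castSucc :=
      pathVertex_castSucc_congr ρ fun k hk => hlt k hk.le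
    have h2 : pathVertex ρ (fun j => l (p, j)) j.succ =
        pathVertex ρ (fun j => l' (p, j)) j.succ := by
      rw [pathVertex_succ, pathVertex_succ, hlt j le_rfl]
    simp only [pathTgt, pathSrc, h1, h2]
  · rintro l l' ⟨p, j⟩ hl heq
    have h1 : pathVertex ρ (fun j => l (p, j)) j.castSucc =
        pathVertex ρ (fun j => l' (p, j)) j.castSucc := by
      refine pathVertex_castSucc_congr ρ fun k hk => hl (p, k) ?_
      simp only [finProdFinEquiv_apply_val]
      rw [Fin.lt_def] at hk
      omega
    simp only [pathTgt, pathSrc, h1, pathVertex_succ] at heq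
    refine Subtype.ext ?_
    split_ifs at heq
    · exact sub_right_inj.1 heq
    · exact sub_left_inj.1 heq

end PathIncrement

/-! ### Moments of the iterates -/

section MomentBound

variable {A : Type*} {Λ : Finset A} {κ : Type*} {m : ℕ}

/-- The weight of the end points of the paths. -/
noncomputable def pathCoeff [Fintype κ] (σ : A → ℂ) (ρ : A) (l : (κ × Bool) × Fin m → Λ) : ℂ :=
  ∏ p : κ × Bool, if p.2 then starRingEnd ℂ (σ (pathVertex ρ (fun j => l (p, j)) (Fin.last m)))
    else σ (pathVertex ρ (fun j => l (p, j)) (Fin.last m))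

lemma norm_pathCoeff_le [Fintype κ] {σ : A → ℂ} (hσ : ∀ a, ‖σ a‖ ≤ 1) (ρ : A)
    (l : (κ × Bool) × Fin m → Λ) : ‖pathCoeff σ ρ l‖ ≤ 1 := by
  rw [pathCoeff, norm_prod]
  refine Finset.prod_le_one (fun _ _ => norm_nonneg _) fun p _ => ?_
  split_ifs
  · rw [RCLike.norm_conj]
    exact hσ _
  · exact hσ _

/-- The even power is a product of `K` factors `T` and `K` factors `conj T`, each of which is a sum
over paths; the Boolean marks the conjugate factors. -/
lemma norm_iterate_pow_eq {H : A → A → ℂ} (hH : ∀ a b, starRingEnd ℂ (H a b) = H b a)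
    (σ : A → ℂ) (ρ : A) (K : ℕ) :
    ((‖iterate H Λ σ m ρ‖ ^ (2 * K) : ℝ) : ℂ) = ∑ l : (Fin K × Bool) × Fin m → Λ,
      pathCoeff σ ρ l * ∏ i, H (pathSrc ρ l i) (pathTgt ρ l i) := by
  classical
  have h1 : ((‖iterate H Λ σ m ρ‖ ^ (2 * K) : ℝ) : ℂ) = ∏ p : Fin K × Bool,
      if p.2 then starRingEnd ℂ (iterate H Λ σ m ρ) else iterate H Λ σ m ρ := by
    rw [Fintype.prod_prod_type]
    simp only [Fintype.prod_bool, if_true, Bool.false_eq_true, if_false, Finset.prod_const,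
      Finset.card_univ, Fintype.card_fin]
    rw [pow_mul, ← Complex.normSq_eq_norm_sq, Complex.ofReal_pow, Complex.normSq_eq_conj_mul_self]
  have h2 : ∀ p : Fin K × Bool,
      (if p.2 then starRingEnd ℂ (iterate H Λ σ m ρ) else iterate H Λ σ m ρ) =
      ∑ f : Fin m → Λ, (if p.2 then starRingEnd ℂ (σ (pathVertex ρ f (Fin.last m)))
          else σ (pathVertex ρ f (Fin.last m))) *
        ∏ j : Fin m, H (if p.2 then pathVertex ρ f j.succ else pathVertex ρ f j.castSucc)
          (if p.2 then pathVertex ρ f j.castSucc else pathVertex ρ f j.succ) := by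
    intro p
    rw [iterate_eq_sum_paths]
    by_cases hp : p.2
    · simp only [hp, if_true, map_sum, map_mul, map_prod, hH]
      exact Finset.sum_congr rfl fun f _ => mul_comm _ _
    · simp only [hp, if_false, Bool.false_eq_true]
      exact Finset.sum_congr rfl fun f _ => mul_comm _ _
  rw [h1, Finset.prod_congr rfl fun p _ => h2 p, Fintype.prod_sum,
    ← (Equiv.curry (Fin K × Bool) (Fin m) Λ).sum_comp]
  refine Finset.sum_congr rfl fun l _ => ?_
  rw [Finset.prod_mul_distrib, Fintype.prod_prod_type (fun i : (Fin K × Bool) × Fin m =>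
    H (pathSrc ρ l i) (pathTgt ρ l i))]
  rfl

lemma length_le_sum_card {ι : Type*} (P : List (Finset ι)) (hne : ∀ E ∈ P, E.Nonempty) :
    P.length ≤ (P.map Finset.card).sum := by
  induction P with
  | nil => simp
  | cons E P ih =>
    have h1 := (hne E (by simp)).card_pos
    have h2 := ih fun E hE => hne E (by simp [hE])
    simp only [List.length_cons, List.map_cons, List.sum_cons]
    omega

/-- The factor `1 / n` for every edge and the factor `S` for every edge but one per block are
distributed over the blocks of a partition. -/
lemma blockWeight_eq {ι : Type*} {n : ℕ} (hn : (n : ℝ) ≠ 0) (S : ℕ) (P : List (Finset ι))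
    (hne : ∀ E ∈ P, E.Nonempty) :
    (1 / n : ℝ) ^ (P.map Finset.card).sum * ((S : ℝ) ^ ((P.map Finset.card).sum - P.length) *
      (P.map fun E => n * clusterWeight E.card).prod) =
      (P.map fun E => clusterWeight E.card * ((S : ℝ) / n) ^ (E.card - 1)).prod := by
  induction P with
  | nil => simp
  | cons E P ih =>
    have hpos := (hne E (by simp)).card_pos
    have hne' : ∀ E ∈ P, E.Nonempty := fun E hE => hne E (by simp [hE])
    have hlen := length_le_sum_card P hne'
    simp only [List.map_cons, List.sum_cons, List.prod_cons, List.length_cons]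
    rw [← ih hne', show E.card + (P.map Finset.card).sum - (P.length + 1) =
      (E.card - 1) + ((P.map Finset.card).sum - P.length) by omega, pow_add, pow_add, div_pow (S : ℝ) (n : ℝ)]
    obtain ⟨k, hk⟩ : ∃ k, E.card = k + 1 := ⟨E.card - 1, by omega⟩
    rw [hk, Nat.add_sub_cancel, pow_succ (1 / (n : ℝ)), one_div_pow]
    field_simp

lemma prod_ite_eq {ι : Type*} (P : List (Finset ι)) (p : Finset ι → Prop) [DecidablePred p]
    (f : Finset ι → ℝ) :
    (P.map fun E => if p E then f E else 0).prod =
      if ∀ E ∈ P, p E then (P.map f).prod else 0 := by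
  induction P with
  | nil => simp
  | cons E P ih =>
    rw [List.map_cons, List.prod_cons, ih]
    by_cases h : p E
    · simp [h]
    · simp [h]

variable {n : ℕ} [NeZero n] {Ω : Type*} [MeasurableSpace Ω] {P : Measure Ω} [IsProbabilityMeasure P]
  {e : ZMod n → Ω → ℂ}

/-- The moments of the iterates are bounded by a sum over all partitions of the set of factors. -/
lemma integral_norm_iterate_pow_le_blockSum (he : IsSteinhausSequence P e)
    (Λ : Finset (ZMod n × ZMod n)) {σ : ZMod n × ZMod n → ℂ} (hσ : ∀ a, ‖σ a‖ ≤ 1)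
    (ρ : ZMod n × ZMod n) (m K : ℕ) :
    ∫ ω, ‖iterate (offGram fun q => e q ω) Λ σ m ρ‖ ^ (2 * K) ∂P ≤
      blockSum (fun E => clusterWeight E.card * ((Λ.card : ℝ) / n) ^ (E.card - 1))
        (Fintype.card ((Fin K × Bool) × Fin m))
        (Finset.univ : Finset ((Fin K × Bool) × Fin m)) := by
  classical
  set N := Fintype.card ((Fin K × Bool) × Fin m) with hN
  have hn : (n : ℝ) ≠ 0 := Nat.cast_ne_zero.2 (NeZero.ne n)
  have h1 : ((∫ ω, ‖iterate (offGram fun q => e q ω) Λ σ m ρ‖ ^ (2 * K) ∂P : ℝ) : ℂ) =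
      ∑ l : (Fin K × Bool) × Fin m → Λ, pathCoeff σ ρ l *
        ∫ ω, ∏ i, offGram (fun q => e q ω) (pathSrc ρ l i) (pathTgt ρ l i) ∂P := by
    rw [← integral_complex_ofReal]
    simp only [fun ω => norm_iterate_pow_eq (Λ := Λ) (m := m)
      (conj_offGram fun q => e q ω) σ ρ K]
    rw [integral_finsetSum]
    · simp only [integral_const_mul]
    · intro l _
      exact (integrable_prod_offGram he _ _).const_mul _
  have h2 : ‖((∫ ω, ‖iterate (offGram fun q => e q ω) Λ σ m ρ‖ ^ (2 * K) ∂P : ℝ) : ℂ)‖ ≤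
      ∑ l : (Fin K × Bool) × Fin m → Λ, (1 / n : ℝ) ^ N *
        blockSum (fun E => if ∑ i ∈ E, (pathTgt ρ l i - pathSrc ρ l i) = 0 then
          n * clusterWeight E.card else 0) N Finset.univ := by
    rw [h1]
    refine (norm_sum_le _ _).trans (Finset.sum_le_sum fun l _ => ?_)
    rw [norm_mul]
    refine (mul_le_of_le_one_left (norm_nonneg _) (norm_pathCoeff_le hσ ρ l)).trans ?_
    exact norm_integral_prod_offGram_le he _ _
  rw [Complex.norm_real, Real.norm_eq_abs] at h2
  refine (le_abs_self _).trans (h2.trans ?_)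
  rw [← Finset.mul_sum]
  have h3 : ∑ l : (Fin K × Bool) × Fin m → Λ,
      blockSum (fun E => if ∑ i ∈ E, (pathTgt ρ l i - pathSrc ρ l i) = 0 then
          (n : ℝ) * clusterWeight E.card else 0) N Finset.univ =
      ((blockLists N Finset.univ).map fun Q => ∑ l : (Fin K × Bool) × Fin m → Λ,
        (Q.map fun E => if ∑ i ∈ E, (pathTgt ρ l i - pathSrc ρ l i) = 0 then
          (n : ℝ) * clusterWeight E.card else 0).prod).sum := by
    simp only [blockSum, Finset.sum]
    exact Multiset.sum_map_sum_map _ _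
  rw [h3, ← Multiset.sum_map_mul_left, blockSum]
  refine Multiset.sum_map_le_sum_map _ _ fun Q hQ => ?_
  obtain ⟨hQ1, hQ2, hQ3⟩ := blockLists_spec N Finset.univ (by rw [Finset.card_univ]) Q hQ
  rw [Finset.card_univ] at hQ3
  have hne : ∀ E ∈ Q, E.Nonempty := fun E hE => (hQ1 E hE).1
  rw [← blockWeight_eq hn Λ.card Q hne, hQ3]
  refine mul_le_mul_of_nonneg_left ?_ (by positivity)
  simp only [prod_ite_eq]
  rw [← Finset.sum_filter, Finset.sum_const, nsmul_eq_mul]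
  refine mul_le_mul_of_nonneg_right ?_ ?_
  · have h4 := card_pathIncrement_le (Λ := Λ) ρ Q hne hQ2
    refine le_trans (Eq.le ?_) (Nat.cast_le (α := ℝ).2 h4) |>.trans (by push_cast; rfl)
    congr!
  · refine List.prod_nonneg fun x hx => ?_
    obtain ⟨E, hE, rfl⟩ := List.mem_map.1 hx
    exact mul_nonneg (Nat.cast_nonneg _) (clusterWeight_nonneg (hne E hE).card_pos.ne')

/-- The moments of order `2 * K` of the `m`-th iterate are at most `κ ^ (2 * K * m)`, as long as the
number `2 * K * m` of factors does not exceed `θ * n / |Λ|`. -/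
lemma integral_norm_iterate_pow_le (he : IsSteinhausSequence P e)
    (Λ : Finset (ZMod n × ZMod n)) {σ : ZMod n × ZMod n → ℂ} (hσ : ∀ a, ‖σ a‖ ≤ 1)
    (ρ : ZMod n × ZMod n) (m K : ℕ) {θ κ : ℝ} (hκ : 0 < κ) (hθ : 3 * θ < κ)
    (hκθ : 3 / 4 * (3 * θ / κ) + 3 / 2 * ((3 * θ / κ) ^ 2 / (1 - 3 * θ / κ)) ≤ κ)
    (hN : (2 * K * m : ℕ) * ((Λ.card : ℝ) / n) ≤ θ) :
    ∫ ω, ‖iterate (offGram fun q => e q ω) Λ σ m ρ‖ ^ (2 * K) ∂P ≤ κ ^ (2 * K * m) := by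
  set x : ℝ := (Λ.card : ℝ) / n with hx
  have hx0 : 0 ≤ x := by positivity
  have hθ0 : 0 ≤ θ := le_trans (by positivity) hN
  set a : ℝ := 3 * θ / κ with ha
  have ha0 : 0 ≤ a := by positivity
  have ha1 : a < 1 := by rw [ha, div_lt_one hκ]; exact hθ
  have hcard : Fintype.card ((Fin K × Bool) × Fin m) = 2 * K * m := by
    simp only [Fintype.card_prod, Fintype.card_fin, Fintype.card_bool]
    ring
  have hmain : ∀ N, N + 1 ≤ 2 * K * m → ∑ k ∈ Finset.range (N + 1),
      (N.choose k : ℝ) * (clusterWeight (k + 1) * x ^ (k + 1 - 1) * κ ^ (N - k)) ≤ κ ^ (N + 1) := by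
    intro N hNle
    have hterm : ∀ k ∈ Finset.range (N + 1),
        (N.choose k : ℝ) * (clusterWeight (k + 1) * x ^ (k + 1 - 1) * κ ^ (N - k)) ≤
        κ ^ N * (a ^ k * (3 * (1 / 2 - (1 / 2) ^ (k + 1)))) := by
      intro k hk
      rw [Finset.mem_range] at hk
      have hfac : (N.choose k : ℝ) * k.factorial ≤ N ^ k := by
        have h1 : N.choose k * k.factorial ≤ N ^ k := by
          rw [mul_comm, ← Nat.descFactorial_eq_factorial_mul_choose]
          exact Nat.descFactorial_le_pow N k
        exact_mod_cast h1
      have hNx : (N : ℝ) * x ≤ θ := by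
        refine le_trans ?_ hN
        have : (N : ℝ) ≤ (2 * K * m : ℕ) := by
          exact_mod_cast (Nat.le_succ N).trans hNle
        gcongr
      have hh : (0 : ℝ) ≤ 1 / 2 - (1 / 2) ^ (k + 1) := by
        have : (1 / 2 : ℝ) ^ (k + 1) ≤ 1 / 2 :=
          pow_le_of_le_one (by norm_num) (by norm_num) (Nat.succ_ne_zero k)
        linarith
      have hpow : κ ^ (N - k) = κ ^ N / κ ^ k := by
        rw [eq_div_iff (by positivity), ← pow_add, Nat.sub_add_cancel (by omega)]
      have hak : a ^ k = 3 ^ k * θ ^ k / κ ^ k := by rw [ha, div_pow, mul_pow]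
      rw [clusterWeight, Nat.add_sub_cancel, hpow, hak]
      calc _ = ((N.choose k : ℝ) * k.factorial) * x ^ k *
            (3 ^ (k + 1) * (1 / 2 - (1 / 2) ^ (k + 1)) * (κ ^ N / κ ^ k)) := by ring
        _ ≤ N ^ k * x ^ k * (3 ^ (k + 1) * (1 / 2 - (1 / 2) ^ (k + 1)) * (κ ^ N / κ ^ k)) := by
            gcongr
        _ = (N * x) ^ k * (3 ^ (k + 1) * (1 / 2 - (1 / 2) ^ (k + 1)) * (κ ^ N / κ ^ k)) := by
            rw [mul_pow]
        _ ≤ θ ^ k * (3 ^ (k + 1) * (1 / 2 - (1 / 2) ^ (k + 1)) * (κ ^ N / κ ^ k)) := by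
            gcongr
        _ = _ := by rw [pow_succ]; ring
    refine (Finset.sum_le_sum hterm).trans ?_
    rw [← Finset.mul_sum, pow_succ]
    refine mul_le_mul_of_nonneg_left ?_ (by positivity)
    refine le_trans ?_ hκθ
    have hsum : ∀ M : ℕ, ∑ k ∈ Finset.range (M + 2), a ^ k * (3 * (1 / 2 - (1 / 2 : ℝ) ^ (k + 1))) ≤
        3 / 4 * a + 3 / 2 * ((a ^ 2 - a ^ (M + 2)) / (1 - a)) := by
      intro M
      induction M with
      | zero =>
        rw [Finset.sum_range_succ, Finset.sum_range_one]
        norm_num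
        linarith
      | succ M ih =>
        rw [Finset.sum_range_succ]
        have h1 : (a ^ 2 - a ^ (M + 1 + 2)) / (1 - a) =
            (a ^ 2 - a ^ (M + 2)) / (1 - a) + a ^ (M + 2) := by
          have : (1 - a) ≠ 0 := by linarith
          field_simp
          ring
        rw [h1]
        have h2 : a ^ (M + 2) * (3 * (1 / 2 - (1 / 2 : ℝ) ^ (M + 2 + 1))) ≤ 3 / 2 * a ^ (M + 2) := by
          have h3 : (0 : ℝ) ≤ (1 / 2) ^ (M + 2 + 1) := by positivity
          have h4 : 0 ≤ a ^ (M + 2) := by positivity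
          nlinarith [mul_nonneg h4 h3]
        linarith [ih, h2, show M + 1 + 1 = M + 2 from rfl]
    have hfin : ∀ M : ℕ, 3 / 4 * a + 3 / 2 * ((a ^ 2 - a ^ (M + 2)) / (1 - a)) ≤
        3 / 4 * a + 3 / 2 * (a ^ 2 / (1 - a)) := by
      intro M
      have h1 : 0 < 1 - a := by linarith
      gcongr
      have : 0 ≤ a ^ (M + 2) := by positivity
      linarith
    cases N with
    | zero =>
      have h1 : 0 < 1 - a := by linarith
      have : 0 ≤ 3 / 4 * a + 3 / 2 * (a ^ 2 / (1 - a)) := by positivity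
      norm_num
      linarith
    | succ M => exact (hsum M).trans (hfin M)
  have h := blockSum_le_pow (ι := (Fin K × Bool) × Fin m)
    (u := fun k => clusterWeight k * x ^ (k - 1)) (κ := κ)
    (fun k hk => mul_nonneg (clusterWeight_nonneg hk) (by positivity)) (N₀ := 2 * K * m) hmain
    (Fintype.card ((Fin K × Bool) × Fin m)) Finset.univ (by rw [Finset.card_univ])
    (by rw [Finset.card_univ, hcard])
  rw [Finset.card_univ, hcard] at h
  refine (integral_norm_iterate_pow_le_blockSum he Λ hσ ρ m K).trans ?_
  rw [hcard]
  exact h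

end MomentBound

/-! ### Dual certificates from the Neumann series -/

section DualCertificate

/-- A dual certificate together with injectivity on the support of `x` makes `x` the unique
minimizer. The certificate is the vector `ρ ↦ Σ_q conj (A q ρ) * h q` in the row space of `A`. -/
lemma basisPursuitRecovers_of_certificate {κ ι : Type*} [Fintype κ] [Fintype ι] (A : Matrix κ ι ℂ)
    (x : ι → ℂ) (h : κ → ℂ)
    (hon : ∀ ρ, x ρ ≠ 0 → ∑ q, starRingEnd ℂ (A q ρ) * h q = x ρ / ‖x ρ‖)
    (hoff : ∀ ρ, x ρ = 0 → ‖∑ q, starRingEnd ℂ (A q ρ) * h q‖ < 1)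
    (hinj : ∀ w : ι → ℂ, (∀ ρ, x ρ = 0 → w ρ = 0) → A.mulVec w = 0 → w = 0) :
    BasisPursuitRecovers A x := by
  intro z hz hne
  set v : ι → ℂ := fun ρ => ∑ q, starRingEnd ℂ (A q ρ) * h q with hv
  have hpair : ∀ w : ι → ℂ, ∑ ρ, starRingEnd ℂ (v ρ) * w ρ =
      ∑ q, starRingEnd ℂ (h q) * A.mulVec w q := by
    intro w
    simp only [hv, map_sum, map_mul, Complex.conj_conj, Finset.sum_mul, Matrix.mulVec, dotProduct,
      Finset.mul_sum]
    rw [Finset.sum_comm]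
    exact Finset.sum_congr rfl fun q _ => Finset.sum_congr rfl fun ρ _ => by ring
  have hx : ∑ ρ, starRingEnd ℂ (v ρ) * x ρ = (l1Norm x : ℂ) := by
    rw [l1Norm, Complex.ofReal_sum]
    refine Finset.sum_congr rfl fun ρ _ => ?_
    by_cases h0 : x ρ = 0
    · simp [h0]
    · have h1 : (‖x ρ‖ : ℂ) ≠ 0 := by simpa using h0
      simp only [hv]
      rw [hon ρ h0, map_div₀, Complex.conj_ofReal, div_mul_eq_mul_div, Complex.conj_mul', sq,
        mul_div_assoc, div_self h1, mul_one]
  have hv1 : ∀ ρ, ‖v ρ‖ ≤ 1 := by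
    intro ρ
    by_cases h0 : x ρ = 0
    · exact (hoff ρ h0).le
    · simp only [hv]
      rw [hon ρ h0, norm_div, Complex.norm_real, norm_norm, div_self (norm_ne_zero_iff.2 h0)]
  obtain ⟨ρ₀, h0, hz0⟩ : ∃ ρ, x ρ = 0 ∧ z ρ ≠ 0 := by
    by_contra! hcon
    refine hne (sub_eq_zero.1 (hinj (z - x) (fun ρ hρ => ?_) ?_))
    · rw [Pi.sub_apply, hcon ρ hρ, hρ, sub_zero]
    · rw [Matrix.mulVec_sub, hz, sub_self]
  calc l1Norm x = ‖∑ ρ, starRingEnd ℂ (v ρ) * z ρ‖ := by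
        rw [hpair, hz, ← hpair, hx, Complex.norm_real, Real.norm_eq_abs, abs_of_nonneg]
        exact Finset.sum_nonneg fun _ _ => norm_nonneg _
    _ ≤ ∑ ρ, ‖v ρ‖ * ‖z ρ‖ := by
        refine (norm_sum_le _ _).trans (Finset.sum_le_sum fun ρ _ => ?_)
        rw [norm_mul, RCLike.norm_conj]
    _ < l1Norm z := by
        refine Finset.sum_lt_sum (fun ρ _ => ?_) ⟨ρ₀, Finset.mem_univ _, ?_⟩
        · exact mul_le_of_le_one_left (norm_nonneg _) (hv1 ρ)
        · exact mul_lt_of_lt_one_left (norm_pos_iff.2 hz0) (hoff ρ₀ h0)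

end DualCertificate

section Neumann

open scoped Matrix.Norms.L2Operator

variable {ι : Type*} [Fintype ι] [DecidableEq ι]

lemma l2_opNorm_sq_le_sum (B : Matrix ι ι ℂ) : ‖B‖ ^ 2 ≤ ∑ i, ∑ j, ‖B i j‖ ^ 2 := by
  have h0 : 0 ≤ ∑ i, ∑ j, ‖B i j‖ ^ 2 :=
    Finset.sum_nonneg fun _ _ => Finset.sum_nonneg fun _ _ => by positivity
  rw [← Real.le_sqrt (norm_nonneg _) h0, Matrix.cstar_norm_def]
  refine ContinuousLinearMap.opNorm_le_bound _ (Real.sqrt_nonneg _) fun x => ?_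
  rw [EuclideanSpace.norm_eq, EuclideanSpace.norm_eq, ← Real.sqrt_mul h0]
  refine Real.sqrt_le_sqrt ?_
  rw [Finset.sum_mul]
  refine Finset.sum_le_sum fun i _ => ?_
  rw [Matrix.ofLp_toEuclideanCLM, Matrix.mulVec, dotProduct]
  calc _ ≤ (∑ j, ‖B i j‖ * ‖x j‖) ^ 2 := by
        gcongr
        refine (norm_sum_le _ _).trans (Finset.sum_le_sum fun j _ => ?_)
        rw [norm_mul]
    _ ≤ _ := Finset.sum_mul_sq_le_sq_mul_sq _ _ _

/-- For a Hermitian matrix the operator norm is controlled by the Frobenius norm of a power. -/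
lemma l2_opNorm_le_of_sum_pow [Nonempty ι] {B : Matrix ι ι ℂ} (hB : IsSelfAdjoint B) {r : ℕ}
    (hr : r ≠ 0) {δ : ℝ} (hδ : 0 ≤ δ) (h : ∑ i, ∑ j, ‖(B ^ r) i j‖ ^ 2 ≤ δ ^ (2 * r)) :
    ‖B‖ ≤ δ := by
  have h1 : ‖B‖ ^ r ≤ ‖B ^ r‖ := by
    have h2 := spectrum.spectralRadius_pow_le (𝕜 := ℂ) B r hr
    rw [hB.spectralRadius_eq_nnnorm, (hB.pow r).spectralRadius_eq_nnnorm] at h2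
    exact_mod_cast h2
  have h2 : ‖B ^ r‖ ^ 2 ≤ (δ ^ r) ^ 2 := by
    rw [← pow_mul, mul_comm r 2]
    exact (l2_opNorm_sq_le_sum _).trans h
  exact le_of_pow_le_pow_left₀ hr hδ (h1.trans (le_of_sq_le_sq h2 (by positivity)))

omit [DecidableEq ι] in
lemma sum_norm_le_sqrt_card_mul_norm (x : EuclideanSpace ℂ ι) :
    ∑ i, ‖x i‖ ≤ √(Fintype.card ι) * ‖x‖ := by
  rw [EuclideanSpace.norm_eq, ← Real.sqrt_mul (Nat.cast_nonneg _)]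
  refine Real.le_sqrt_of_sq_le ?_
  have := Finset.sum_mul_sq_le_sq_mul_sq Finset.univ (fun _ : ι => (1 : ℝ)) (fun i => ‖x i‖)
  simpa using this

/-- The solution `p` of `p + B p = σ` is a partial sum of the Neumann series up to a small
remainder. -/
lemma exists_neumann {B : Matrix ι ι ℂ} {δ : ℝ} (hδ1 : δ < 1) (hB : ‖B‖ ≤ δ)
    {σ : ι → ℂ} (hσ : ∀ i, ‖σ i‖ ≤ 1) (M : ℕ) :
    (∀ w : ι → ℂ, w + B.mulVec w = 0 → w = 0) ∧ ∃ p R : ι → ℂ, p + B.mulVec p = σ ∧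
      p = ∑ k ∈ Finset.range M, (-1 : ℂ) ^ k • (B ^ k).mulVec σ + R ∧
      ∑ i, ‖R i‖ ≤ Fintype.card ι * δ ^ M / (1 - δ) := by
  have hδ0 : 0 ≤ δ := (norm_nonneg _).trans hB
  set T := Matrix.toEuclideanCLM (n := ι) (𝕜 := ℂ) B with hT
  have hTn : ‖T‖ ≤ δ := hB
  have hinj : ∀ w : EuclideanSpace ℂ ι, w + T w = 0 → w = 0 := by
    intro w hw
    have h1 : ‖w‖ ≤ δ * ‖w‖ := by
      calc ‖w‖ = ‖T w‖ := (congrArg norm (eq_neg_of_add_eq_zero_left hw)).trans (norm_neg _)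
        _ ≤ ‖T‖ * ‖w‖ := T.le_opNorm w
        _ ≤ δ * ‖w‖ := by gcongr
    have h2 : ‖w‖ = 0 := by nlinarith [norm_nonneg w]
    exact norm_eq_zero.1 h2
  let F : EuclideanSpace ℂ ι →ₗ[ℂ] EuclideanSpace ℂ ι := LinearMap.id + T.toLinearMap
  have hsurj : Function.Surjective F := by
    refine LinearMap.surjective_of_injective ((injective_iff_map_eq_zero _).2 fun w hw => ?_)
    exact hinj w hw
  refine ⟨fun w hw => ?_, ?_⟩
  · have := hinj (WithLp.toLp 2 w) (by
      rw [hT, Matrix.toEuclideanCLM_toLp, ← WithLp.toLp_add, hw]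
      rfl)
    simpa using this
  obtain ⟨p, hp⟩ := hsurj (WithLp.toLp 2 σ)
  have hp' : p + T p = WithLp.toLp 2 σ := hp
  have hσn : ‖(WithLp.toLp 2 σ : EuclideanSpace ℂ ι)‖ ≤ √(Fintype.card ι) := by
    rw [EuclideanSpace.norm_eq]
    refine Real.sqrt_le_sqrt ?_
    calc ∑ i, ‖σ i‖ ^ 2 ≤ ∑ _i : ι, (1 : ℝ) :=
          Finset.sum_le_sum fun i _ => pow_le_one₀ (norm_nonneg _) (hσ i)
      _ = Fintype.card ι := by simp
  have hpn : ‖p‖ ≤ √(Fintype.card ι) / (1 - δ) := by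
    rw [le_div_iff₀ (by linarith)]
    have h1 : ‖p‖ ≤ ‖(WithLp.toLp 2 σ : EuclideanSpace ℂ ι)‖ + ‖T p‖ := by
      have h3 : p = WithLp.toLp 2 σ - T p := eq_sub_of_add_eq hp'
      exact (congrArg norm h3).le.trans (norm_sub_le _ _)
    have h2 : ‖T p‖ ≤ δ * ‖p‖ := (T.le_opNorm p).trans (by gcongr)
    nlinarith
  have hpow : ∀ k, ‖(T ^ k) p‖ ≤ δ ^ k * ‖p‖ := by
    intro k
    refine ((T ^ k).le_opNorm p).trans ?_
    gcongr
    induction k with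
    | zero =>
      rw [pow_zero, pow_zero]
      exact ContinuousLinearMap.norm_id_le
    | succ k ih =>
      rw [pow_succ, pow_succ]
      exact (norm_mul_le _ _).trans (by gcongr)
  have happly : ∀ k (y : EuclideanSpace ℂ ι), (T ^ k) y = WithLp.toLp 2 ((B ^ k).mulVec y.ofLp) := by
    intro k y
    rw [hT, ← map_pow, ← Matrix.ofLp_toEuclideanCLM]
  refine ⟨p.ofLp, ((-1 : ℂ) ^ M • (T ^ M) p).ofLp, ?_, ?_, ?_⟩
  · rw [← Matrix.ofLp_toEuclideanCLM, ← hT, ← WithLp.ofLp_add, hp']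
  · have h1 : ∀ M : ℕ, p = ∑ k ∈ Finset.range M, (-1 : ℂ) ^ k • (T ^ k) (WithLp.toLp 2 σ) +
        (-1 : ℂ) ^ M • (T ^ M) p := by
      intro M
      induction M with
      | zero => simp
      | succ M ih =>
        rw [Finset.sum_range_succ]
        conv_lhs => rw [ih]
        rw [add_assoc, ← hp', map_add, pow_succ T, pow_succ (-1 : ℂ), mul_apply_eq_comp]
        simp
    conv_lhs => rw [h1 M]
    simp [happly]
  · refine (sum_norm_le_sqrt_card_mul_norm _).trans ?_
    rw [norm_smul, norm_pow, norm_neg, norm_one, one_pow, one_mul]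
    calc √(Fintype.card ι) * ‖(T ^ M) p‖
        ≤ √(Fintype.card ι) * (δ ^ M * (√(Fintype.card ι) / (1 - δ))) := by
          gcongr
          exact (hpow M).trans (by gcongr)
      _ = (√(Fintype.card ι) * √(Fintype.card ι)) * δ ^ M / (1 - δ) := by ring
      _ = _ := by rw [Real.mul_self_sqrt (Nat.cast_nonneg _)]

end Neumann

section Certificate

variable {A : Type*}

lemma iterate_eq_mulVec_pow [DecidableEq A] (H : A → A → ℂ) (Λ : Finset A) (σ : A → ℂ) (m : ℕ) (a : Λ) :
    iterate H Λ σ m a =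
      ((Matrix.of fun i j : Λ => H i j) ^ m).mulVec (fun b => σ b) a := by
  induction m generalizing a with
  | zero => simp [iterate]
  | succ m ih =>
    rw [iterate, pow_succ', ← Matrix.mulVec_mulVec]
    simp only [ih]
    rfl

/-- A small Frobenius norm of a power of `H`, restricted to `Λ`, yields the inverse of `1 + H`
there, and the values of `H (1 + H)⁻¹ σ` are bounded by the iterates and a remainder. -/
lemma exists_certificate [DecidableEq A] {H : A → A → ℂ}
    (hH : ∀ a b, starRingEnd ℂ (H a b) = H b a)
    {Λ : Finset A} (hΛ : Λ.Nonempty) {σ : A → ℂ} (hσ : ∀ a, ‖σ a‖ ≤ 1) {δ : ℝ} (hδ : 0 ≤ δ)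
    (hδ1 : δ < 1) {r : ℕ} (hr : r ≠ 0)
    (hF : ∑ a : Λ, ∑ b : Λ, ‖iterate H Λ (Pi.single (b : A) 1) r a‖ ^ 2 ≤ δ ^ (2 * r)) (M : ℕ) :
    (∀ w : Λ → ℂ, (∀ a : Λ, w a + ∑ b : Λ, H a b * w b = 0) → w = 0) ∧
    ∃ p : Λ → ℂ, (∀ a : Λ, p a + ∑ b : Λ, H a b * p b = σ a) ∧
      ∀ ρ, (∀ b, ‖H ρ b‖ ≤ 1) → ‖∑ b : Λ, H ρ b * p b‖ ≤
        ∑ m ∈ Finset.range M, ‖iterate H Λ σ (m + 1) ρ‖ + Λ.card * δ ^ M / (1 - δ) := by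
  set B : Matrix Λ Λ ℂ := Matrix.of fun i j : Λ => H i j with hBdef
  have : Nonempty Λ := hΛ.to_subtype
  have hsa : IsSelfAdjoint B := by
    ext i j
    exact hH j i
  have hB := l2_opNorm_le_of_sum_pow hsa hr hδ (by
    refine le_trans (Eq.le ?_) hF
    refine Finset.sum_congr rfl fun a _ => Finset.sum_congr rfl fun b _ => ?_
    rw [iterate_eq_mulVec_pow, ← hBdef]
    congr 2
    have : (fun c : Λ => (Pi.single (b : A) (1 : ℂ) : A → ℂ) c) = Pi.single b 1 := by
      ext c
      by_cases h : c = b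
      · rw [h, Pi.single_eq_same, Pi.single_eq_same]
      · rw [Pi.single_eq_of_ne h, Pi.single_eq_of_ne fun h' => h (Subtype.ext h')]
    rw [this, Matrix.mulVec_single_one]
    rfl)
  obtain ⟨h1, p, R, h2, h3, h4⟩ := exists_neumann hδ1 hB (σ := fun a : Λ => σ a) (fun a => hσ a) M
  refine ⟨fun w hw => h1 w (funext fun a => hw a), p, fun a => congrFun h2 a, fun ρ hρ => ?_⟩
  have h5 : ∀ b, p b = ∑ k ∈ Finset.range M, (-1 : ℂ) ^ k * iterate H Λ σ k b + R b := by
    intro b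
    conv_lhs => rw [h3]
    rw [Pi.add_apply, Finset.sum_apply]
    congr 1
    exact Finset.sum_congr rfl fun k _ => by
      rw [Pi.smul_apply, smul_eq_mul, iterate_eq_mulVec_pow H Λ σ k b]
  have h6 : ∑ b : Λ, H ρ b * p b =
      ∑ k ∈ Finset.range M, (-1 : ℂ) ^ k * iterate H Λ σ (k + 1) ρ + ∑ b : Λ, H ρ b * R b := by
    have h7 : ∀ k, iterate H Λ σ (k + 1) ρ = ∑ b : Λ, H ρ b * iterate H Λ σ k b := fun _ => rfl
    rw [Finset.sum_congr rfl fun (b : Λ) _ => congrArg (H ρ b * ·) (h5 b)]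
    simp only [h7, mul_add, Finset.sum_add_distrib, Finset.mul_sum]
    rw [Finset.sum_comm]
    congr 1
    exact Finset.sum_congr rfl fun k _ => Finset.sum_congr rfl fun b _ => by ring
  rw [h6]
  refine (norm_add_le _ _).trans (add_le_add ?_ ?_)
  · refine (norm_sum_le _ _).trans (Finset.sum_le_sum fun k _ => ?_)
    simp
  · rw [Fintype.card_coe] at h4
    refine le_trans ?_ h4
    refine (norm_sum_le _ _).trans (Finset.sum_le_sum fun b _ => ?_)
    rw [norm_mul]
    exact mul_le_of_le_one_left (norm_nonneg _) (hρ b)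

end Certificate

section Gabor

variable {n : ℕ} [NeZero n]

/-- The Gram matrix of the columns: different modulations of the same translate of the window are
orthogonal, because the window has constant modulus. -/
lemma sum_conj_gaborMatrix_mul {Ω : Type*} (e : ZMod n → Ω → ℂ) (ω : Ω) (he : ∀ q, ‖e q ω‖ = 1)
    (l l' : ZMod n × ZMod n) :
    ∑ q, starRingEnd ℂ (gaborMatrix (randomWindow e ω) q l) * gaborMatrix (randomWindow e ω) q l' =
      (if l = l' then 1 else 0) + offGram (fun q => e q ω) l l' := by
  have hn : (n : ℂ) ≠ 0 := Nat.cast_ne_zero.2 (NeZero.ne n)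
  have hsq : ((1 / √(n : ℝ) : ℝ) : ℂ) * ((1 / √(n : ℝ) : ℝ) : ℂ) = 1 / n := by
    rw [← Complex.ofReal_mul, one_div_mul_one_div, Real.mul_self_sqrt (Nat.cast_nonneg _)]
    simp
  have h1 : ∀ q, starRingEnd ℂ (gaborMatrix (randomWindow e ω) q l) *
      gaborMatrix (randomWindow e ω) q l' = (1 / n : ℂ) * (ZMod.stdAddChar ((l'.2 - l.2) * q) *
        (starRingEnd ℂ (e (q + l.1) ω) * e (q + l'.1) ω)) := by
    intro q
    simp only [gaborMatrix, Matrix.of_apply, timeFreqShift, gaborModulation, gaborShift,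
      randomWindow, map_mul, Complex.conj_ofReal]
    rw [← hsq, sub_mul, sub_eq_add_neg, AddChar.map_add_eq_mul, AddChar.map_neg_eq_conj,
      add_comm l.1 q, add_comm l'.1 q]
    ring
  simp only [h1]
  rw [← Finset.mul_sum]
  unfold offGram
  by_cases h : l.1 = l'.1
  · rw [if_pos h, add_zero]
    have h2 : ∀ q, (ZMod.stdAddChar ((l'.2 - l.2) * q) : ℂ) *
        (starRingEnd ℂ (e (q + l.1) ω) * e (q + l'.1) ω) = ZMod.stdAddChar (q * (l'.2 - l.2)) := by
      intro q
      rw [h, Complex.conj_mul', he, mul_comm (l'.2 - l.2)]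
      simp
    simp only [h2]
    rw [AddChar.sum_mulShift _ (ZMod.isPrimitive_stdAddChar n), ZMod.card]
    by_cases h3 : l = l'
    · rw [if_pos (by rw [h3, sub_self]), if_pos h3, one_div_mul_cancel hn]
    · rw [if_neg (fun h4 => h3 (Prod.ext h (sub_eq_zero.1 h4).symm)), if_neg h3]
      simp
  · rw [if_neg h, if_neg (fun h' => h (by rw [h'])), zero_add]

lemma norm_offGram_le {ε : ZMod n → ℂ} (hε : ∀ q, ‖ε q‖ = 1) (l l' : ZMod n × ZMod n) :
    ‖offGram ε l l'‖ ≤ 1 := by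
  have hn : (n : ℝ) ≠ 0 := Nat.cast_ne_zero.2 (NeZero.ne n)
  unfold offGram
  split_ifs
  · simp
  · rw [norm_mul]
    have h1 : ‖∑ q, (ZMod.stdAddChar ((l'.2 - l.2) * q) : ℂ) *
        (starRingEnd ℂ (ε (q + l.1)) * ε (q + l'.1))‖ ≤ n := by
      refine (norm_sum_le _ _).trans (Eq.le ?_)
      simp [hε, ZMod.card]
    calc _ ≤ ‖(1 / n : ℂ)‖ * n := by gcongr
      _ = 1 := by simp [hn]

/-- Recovery holds as soon as a power of the off-diagonal Gram matrix of the support is small and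
the first iterates of the sign vector are small. -/
lemma basisPursuitRecovers_of_iterate {Ω : Type*} (e : ZMod n → Ω → ℂ) (ω : Ω)
    (he : ∀ q, ‖e q ω‖ = 1) (x : ZMod n × ZMod n → ℂ) {Λ : Finset (ZMod n × ZMod n)}
    (hΛ : Λ.Nonempty) (hx : ∀ a, a ∈ Λ ↔ x a ≠ 0) {δ : ℝ} (hδ : 0 ≤ δ)
    (hδ1 : δ < 1) {r : ℕ} (hr : r ≠ 0)
    (hF : ∑ a : Λ, ∑ b : Λ, ‖iterate (offGram fun q => e q ω) Λ
      (Pi.single (b : ZMod n × ZMod n) 1) r a‖ ^ 2 ≤ δ ^ (2 * r)) (M : ℕ)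
    (hM : ∀ ρ, ∑ m ∈ Finset.range M, ‖iterate (offGram fun q => e q ω) Λ (fun a => x a / ‖x a‖)
      (m + 1) ρ‖ + Λ.card * δ ^ M / (1 - δ) < 1) :
    BasisPursuitRecovers (gaborMatrix (randomWindow e ω)) x := by
  have hσ : ∀ a, ‖x a / (‖x a‖ : ℂ)‖ ≤ 1 := by
    intro a
    rw [norm_div, Complex.norm_real, norm_norm]
    exact div_self_le_one _
  obtain ⟨h1, p, h2, h3⟩ := exists_certificate (conj_offGram fun q => e q ω) hΛ hσ hδ hδ1 hr hF M
  set Ψ := gaborMatrix (randomWindow e ω) with hΨ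
  have hval : ∀ ρ, ∑ q, starRingEnd ℂ (Ψ q ρ) * (∑ b : Λ, Ψ q b * p b) =
      (∑ b : Λ, if ρ = b then p b else 0) + ∑ b : Λ, offGram (fun q => e q ω) ρ b * p b := by
    intro ρ
    simp only [Finset.mul_sum]
    rw [Finset.sum_comm, ← Finset.sum_add_distrib]
    refine Finset.sum_congr rfl fun b _ => ?_
    simp only [← mul_assoc]
    rw [← Finset.sum_mul, sum_conj_gaborMatrix_mul e ω he]
    split_ifs <;> ring
  refine basisPursuitRecovers_of_certificate Ψ x (fun q => ∑ b : Λ, Ψ q b * p b) ?_ ?_ ?_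
  · intro ρ hρ
    rw [hval, ← h2 ⟨ρ, (hx ρ).2 hρ⟩]
    congr 1
    rw [Finset.sum_eq_single ⟨ρ, (hx ρ).2 hρ⟩]
    · simp
    · intro b _ hb
      rw [if_neg fun h => hb (Subtype.ext h.symm)]
    · simp
  · intro ρ hρ
    rw [hval, Finset.sum_eq_zero, zero_add]
    · exact (h3 ρ fun b => norm_offGram_le he _ _).trans_lt (hM ρ)
    · intro b _
      rw [if_neg]
      rintro rfl
      exact (hx _).1 b.2 hρ
  · intro w hw hΨw
    have hsupp : ∀ f : ZMod n × ZMod n → ℂ, ∑ l, f l * w l = ∑ b : Λ, f b * w b := by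
      intro f
      rw [Finset.sum_coe_sort Λ fun b => f b * w b]
      refine (Finset.sum_subset (Finset.subset_univ _) fun b _ hb => ?_).symm
      rw [hw b (by_contra fun h => hb ((hx b).2 h)), mul_zero]
    have h4 := h1 (fun b => w b) (by
      intro a
      have h5 : ∑ q, starRingEnd ℂ (Ψ q a) * Ψ.mulVec w q = 0 := by simp [hΨw]
      simp only [Matrix.mulVec, dotProduct, Finset.mul_sum] at h5
      rw [Finset.sum_comm] at h5
      simp only [← mul_assoc] at h5
      simp only [← Finset.sum_mul] at h5
      simp only [hΨ, sum_conj_gaborMatrix_mul e ω he, add_mul, Finset.sum_add_distrib] at h5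
      rw [hsupp (fun l => offGram (fun q => e q ω) a l)] at h5
      simpa using h5)
    funext a
    by_cases ha : x a = 0
    · exact hw a ha
    · exact congrFun h4 ⟨a, (hx a).2 ha⟩

end Gabor

/-! ### Probability of recovery -/

section Tail

variable {n : ℕ} [NeZero n] {Ω : Type*} [MeasurableSpace Ω] {P : Measure Ω} [IsProbabilityMeasure P]
  {e : ZMod n → Ω → ℂ}

lemma integrable_norm_iterate_pow (he : IsSteinhausSequence P e) (Λ : Finset (ZMod n × ZMod n))
    (σ : ZMod n × ZMod n → ℂ) (ρ : ZMod n × ZMod n) (m K : ℕ) :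
    Integrable (fun ω => ‖iterate (offGram fun q => e q ω) Λ σ m ρ‖ ^ (2 * K)) P := by
  classical
  have h : Integrable (fun ω =>
      ((‖iterate (offGram fun q => e q ω) Λ σ m ρ‖ ^ (2 * K) : ℝ) : ℂ)) P := by
    simp only [fun ω => norm_iterate_pow_eq (Λ := Λ) (m := m) (conj_offGram fun q => e q ω) σ ρ K]
    exact integrable_finsetSum _ fun l _ => (integrable_prod_offGram he _ _).const_mul _
  exact h.re

omit [IsProbabilityMeasure P] in
lemma measureReal_ge_le_div {f : Ω → ℝ} (hf : ∀ ω, 0 ≤ f ω) (hint : Integrable f P) {b c : ℝ}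
    (hb : ∫ ω, f ω ∂P ≤ b) (hc : 0 < c) : P.real {ω | c ≤ f ω} ≤ b / c := by
  rw [le_div_iff₀' hc]
  exact (mul_meas_ge_le_integral_of_nonneg (Filter.Eventually.of_forall hf) hint c).trans hb

/-- Markov's inequality for the moment bound with `κ = 0.26`, at the level `(9 / 20) ^ m`; the ratio
is `0.26 / (9 / 20) = 26 / 45`. -/
lemma measureReal_norm_iterate_ge_le (he : IsSteinhausSequence P e)
    (Λ : Finset (ZMod n × ZMod n)) {σ : ZMod n × ZMod n → ℂ} (hσ : ∀ a, ‖σ a‖ ≤ 1)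
    (ρ : ZMod n × ZMod n) (m K : ℕ) (hN : (2 * K * m : ℕ) * ((Λ.card : ℝ) / n) ≤ 5 / 273.5) :
    P.real {ω | (9 / 20 : ℝ) ^ (2 * K * m) ≤
      ‖iterate (offGram fun q => e q ω) Λ σ m ρ‖ ^ (2 * K)} ≤ (26 / 45) ^ (2 * K * m) := by
  refine (measureReal_ge_le_div (fun ω => by positivity)
    (integrable_norm_iterate_pow he Λ σ ρ m K) (integral_norm_iterate_pow_le he Λ hσ ρ m K
      (θ := 5 / 273.5) (κ := 0.26) (by norm_num) (by norm_num) (by norm_num) hN)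
    (by positivity)).trans (Eq.le ?_)
  rw [← div_pow]
  norm_num

/-- Markov's inequality for the squared Frobenius norm of the `r`-th power, whose entries are the
iterates of the unit vectors. -/
lemma measureReal_sum_norm_iterate_sq_ge_le (he : IsSteinhausSequence P e)
    (Λ : Finset (ZMod n × ZMod n)) (r : ℕ)
    (hN : (2 * r : ℕ) * ((Λ.card : ℝ) / n) ≤ 5 / 273.5) :
    P.real {ω | (9 / 20 : ℝ) ^ (2 * r) ≤ ∑ a : Λ, ∑ b : Λ,
      ‖iterate (offGram fun q => e q ω) Λ (Pi.single (b : ZMod n × ZMod n) 1) r a‖ ^ 2} ≤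
      Λ.card ^ 2 * (26 / 45) ^ (2 * r) := by
  have hint : ∀ a b : Λ, Integrable (fun ω =>
      ‖iterate (offGram fun q => e q ω) Λ (Pi.single (b : ZMod n × ZMod n) 1) r a‖ ^ 2) P :=
    fun a b => integrable_norm_iterate_pow he Λ _ _ r 1
  have hle : ∀ a b : Λ, ∫ ω,
      ‖iterate (offGram fun q => e q ω) Λ (Pi.single (b : ZMod n × ZMod n) 1) r a‖ ^ 2 ∂P ≤
      0.26 ^ (2 * r) := by
    intro a b
    refine integral_norm_iterate_pow_le he Λ (fun c => ?_) a r 1 (θ := 5 / 273.5) (κ := 0.26)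
      (by norm_num) (by norm_num) (by norm_num) (by simpa using hN)
    rw [Pi.single_apply]
    split_ifs <;> simp
  refine (measureReal_ge_le_div (b := Λ.card ^ 2 * 0.26 ^ (2 * r))
    (fun ω => Finset.sum_nonneg fun _ _ => Finset.sum_nonneg fun _ _ => by positivity)
    (integrable_finsetSum _ fun a _ => integrable_finsetSum _ fun b _ => hint a b) ?_
    (by positivity)).trans (Eq.le ?_)
  · rw [integral_finsetSum _ fun a _ => integrable_finsetSum _ fun b _ => hint a b]
    calc _ ≤ ∑ _a : Λ, ∑ _b : Λ, (0.26 : ℝ) ^ (2 * r) := by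
          refine Finset.sum_le_sum fun a _ => ?_
          rw [integral_finsetSum _ fun b _ => hint a b]
          exact Finset.sum_le_sum fun b _ => hle a b
      _ = _ := by simp; ring
  · rw [mul_div_assoc, ← div_pow]
    norm_num

end Tail

section Numbers

lemma pow_le_exp_neg {q t : ℝ} {N : ℕ} (hq : 0 ≤ q) (hq1 : q ≤ Real.exp (-(1 / 2))) (ht : t ≤ N) :
    q ^ N ≤ Real.exp (-(t / 2)) := by
  calc q ^ N ≤ Real.exp (-(1 / 2)) ^ N := by gcongr
    _ = Real.exp (-(N / 2)) := by rw [← Real.exp_nat_mul]; congr 1; ring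
    _ ≤ _ := by gcongr

lemma le_exp_neg_half : (26 / 45 : ℝ) ≤ Real.exp (-(1 / 2)) := by
  have h1 : Real.exp (1 / 2) ^ 2 = Real.exp 1 := by rw [← Real.exp_nat_mul]; norm_num
  have h2 := Real.exp_one_lt_d9
  have h3 : Real.exp (1 / 2) ≤ 45 / 26 := by
    refine le_of_sq_le_sq ?_ (by norm_num)
    rw [h1]
    linarith
  rw [Real.exp_neg, le_inv_comm₀ (by norm_num) (Real.exp_pos _)]
  linarith

/-- The sample size condition forces `n` to be large, unless `n = 1`. -/
lemma sixteen_le_log {n : ℕ} (hn : 2 ≤ n) {L : ℝ} (hL : 2 * Real.log n ≤ L)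
    (hLn : 273.5 * L ≤ n) : 16 ≤ L := by
  have h2 := Real.log_two_gt_d9
  have hpow : ∀ k : ℕ, (2 : ℝ) ^ k ≤ n → k * Real.log 2 ≤ Real.log n := by
    intro k hk
    rw [← Real.log_pow]
    exact Real.log_le_log (by positivity) hk
  have ha := hpow 1 (by rw [pow_one]; exact_mod_cast hn)
  have hb := hpow 8 (by norm_num1; norm_num1 at ha; linarith)
  have hc := hpow 11 (by norm_num1; norm_num1 at hb; linarith)
  have hd := hpow 12 (by norm_num1; norm_num1 at hc; linarith)
  norm_num1 at hd
  linarith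

lemma succ_mul_exp_neg_le {L : ℝ} (hL : 16 ≤ L) : (L + 1) * Real.exp (-(L / 2)) ≤ 1 := by
  have h := Real.quadratic_le_exp_of_nonneg (x := L / 2) (by linarith)
  rw [Real.exp_neg, ← div_eq_mul_inv, div_le_one (Real.exp_pos _)]
  nlinarith

lemma mul_div_le_of_le {s n L N : ℝ} (hn : 0 < n) (hs : 0 ≤ s) (hN : N ≤ 5 * L)
    (hS : 273.5 * s * L ≤ n) : N * (s / n) ≤ 5 / 273.5 := by
  rw [← mul_div_assoc, div_le_div_iff₀ hn (by norm_num)]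
  have := mul_le_mul_of_nonneg_right hN hs
  linarith

end Numbers

section Recovery

variable {n : ℕ} [NeZero n] {Ω : Type*} [MeasurableSpace Ω] {P : Measure Ω} [IsProbabilityMeasure P]
  {e : ZMod n → Ω → ℂ}

omit [MeasurableSpace Ω] in
/-- In dimension one the synthesis matrix is a single unimodular entry. -/
lemma basisPursuitRecovers_of_eq_one (hn : n = 1) (ω : Ω) (he : ∀ q, ‖e q ω‖ = 1)
    {x : ZMod n × ZMod n → ℂ} {Λ : Finset (ZMod n × ZMod n)} (hΛ : Λ.Nonempty)
    (hx : ∀ a, a ∈ Λ ↔ x a ≠ 0) : BasisPursuitRecovers (gaborMatrix (randomWindow e ω)) x := by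
  have h0 : ∀ a b, offGram (fun q => e q ω) a b = 0 := by
    subst hn
    intro a b
    exact if_pos (Subsingleton.elim _ _)
  have h1 : ∀ σ a, iterate (offGram fun q => e q ω) Λ σ 1 a = 0 := by
    intro σ a
    exact Finset.sum_eq_zero fun b _ => by rw [h0, zero_mul]
  refine basisPursuitRecovers_of_iterate e ω he x hΛ hx (δ := 0) le_rfl one_pos one_ne_zero ?_ 1 ?_
  · simp [h1]
  · intro ρ
    simp [h1]

/-- The probability that one of the first `L = log (n² / ε)` iterates is large at some point. -/
lemma measureReal_iUnion_ge_le (he : IsSteinhausSequence P e) {ε : ℝ}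
    (hε : 0 < ε) (Λ : Finset (ZMod n × ZMod n)) {σ : ZMod n × ZMod n → ℂ} (hσ : ∀ a, ‖σ a‖ ≤ 1)
    {L : ℝ} (hL : L = Real.log ((n : ℝ) ^ 2 / ε)) (hL0 : 16 ≤ L)
    (hS : 273.5 * (Λ.card : ℝ) * L ≤ n) :
    P.real (⋃ m ∈ Finset.range ⌊L⌋₊, ⋃ ρ ∈ (Finset.univ : Finset (ZMod n × ZMod n)),
      {ω | (9 / 20 : ℝ) ^ (m + 1) ≤ ‖iterate (offGram fun q => e q ω) Λ σ (m + 1) ρ‖}) ≤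
      ε * (L * Real.exp (-(L / 2))) := by
  have hn0 : (0 : ℝ) < n := Nat.cast_pos.2 (NeZero.pos n)
  have hexp : (n : ℝ) ^ 2 = ε * Real.exp L := by
    rw [hL, Real.exp_log (by positivity)]
    field_simp
  have hMle : (⌊L⌋₊ : ℝ) ≤ L := Nat.floor_le (by linarith)
  have hone : ∀ m ∈ Finset.range ⌊L⌋₊, ∀ ρ : ZMod n × ZMod n,
      P.real {ω | (9 / 20 : ℝ) ^ (m + 1) ≤ ‖iterate (offGram fun q => e q ω) Λ σ (m + 1) ρ‖} ≤
        Real.exp (-(3 * L / 2)) := by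
    intro m hm ρ
    have hmL : ((m + 1 : ℕ) : ℝ) ≤ L :=
      le_trans (by exact_mod_cast Nat.succ_le_of_lt (Finset.mem_range.1 hm)) hMle
    have hm0 : (0 : ℝ) < (m + 1 : ℕ) := by positivity
    -- about `3 * L` factors make each probability as small as `exp (-3 * L / 2)`, which beats the
    -- number `n ^ 2 * L` of events; rounding keeps the number of factors below `5 * L`
    set K := ⌈3 * L / (2 * (m + 1 : ℕ))⌉₊ with hK
    have hK1 : 3 * L ≤ (2 * K * (m + 1) : ℕ) := by
      have := Nat.le_ceil (3 * L / (2 * (m + 1 : ℕ)))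
      rw [← hK, div_le_iff₀ (by positivity)] at this
      push_cast at this ⊢
      linarith
    have hK2 : ((2 * K * (m + 1) : ℕ) : ℝ) ≤ 5 * L := by
      have := (Nat.ceil_lt_add_one (a := 3 * L / (2 * (m + 1 : ℕ))) (by positivity)).le
      rw [← hK, ← sub_le_iff_le_add, le_div_iff₀ (by positivity)] at this
      push_cast at this hmL ⊢
      linarith
    have hN : (2 * K * (m + 1) : ℕ) * ((Λ.card : ℝ) / n) ≤ 5 / 273.5 :=
      mul_div_le_of_le hn0 (Nat.cast_nonneg _) hK2 hS
    refine le_trans ?_ ((measureReal_norm_iterate_ge_le he Λ hσ ρ (m + 1) K hN).trans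
      (pow_le_exp_neg (by norm_num) le_exp_neg_half hK1))
    refine measureReal_mono fun ω hω => ?_
    rw [Set.mem_ofPred_eq] at hω ⊢
    rw [mul_comm (2 * K), pow_mul]
    exact pow_le_pow_left₀ (by positivity) hω _
  calc _ ≤ ∑ m ∈ Finset.range ⌊L⌋₊, ∑ _ρ : ZMod n × ZMod n, Real.exp (-(3 * L / 2)) := by
        refine (measureReal_biUnion_finset_le _ _).trans (Finset.sum_le_sum fun m hm => ?_)
        exact (measureReal_biUnion_finset_le _ _).trans (Finset.sum_le_sum fun ρ _ => hone m hm ρ)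
    _ = ⌊L⌋₊ * ((n : ℝ) ^ 2 * Real.exp (-(3 * L / 2))) := by
        simp [ZMod.card, sq]
    _ ≤ L * ((n : ℝ) ^ 2 * Real.exp (-(3 * L / 2))) := by gcongr
    _ = _ := by
        rw [hexp, show -(3 * L / 2) = -L + -(L / 2) by ring, Real.exp_add, Real.exp_neg L]
        field_simp

/-- Recovery with probability at least `1 - ε`, for a nonempty support `Λ`. -/
lemma one_sub_le_measureReal_recovers (he : IsSteinhausSequence P e) {ε : ℝ} (hε : 0 < ε)
    (hε1 : ε < 1) {x : ZMod n × ZMod n → ℂ} {Λ : Finset (ZMod n × ZMod n)} (hΛ : Λ.Nonempty)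
    (hx : ∀ a, a ∈ Λ ↔ x a ≠ 0)
    (hS : 273.5 * (Λ.card : ℝ) * Real.log ((n : ℝ) ^ 2 / ε) ≤ n) :
    1 - ε ≤ P.real {ω | BasisPursuitRecovers (gaborMatrix (randomWindow e ω)) x} := by
  set G := {ω | BasisPursuitRecovers (gaborMatrix (randomWindow e ω)) x} with hG
  suffices hbad : P.real Gᶜ ≤ ε by
    have h1 : P.real (G ∪ Gᶜ) ≤ P.real G + P.real Gᶜ := measureReal_union_le _ _
    rw [Set.union_compl_self, probReal_univ] at h1
    linarith
  have hN0 : P.real {ω | ¬ ∀ q, ‖e q ω‖ = 1} = 0 := by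
    rw [measureReal_def, ae_iff.1 (steinhaus_ae_norm_eq_one he), ENNReal.toReal_zero]
  have hn0 : (0 : ℝ) < n := Nat.cast_pos.2 (NeZero.pos n)
  rcases (Nat.one_le_iff_ne_zero.2 (NeZero.ne n)).eq_or_lt with hn | hn
  · have hsub : Gᶜ ⊆ {ω | ¬ ∀ q, ‖e q ω‖ = 1} := by
      intro ω hω hω'
      exact hω (basisPursuitRecovers_of_eq_one hn.symm ω hω' hΛ hx)
    exact (measureReal_mono hsub).trans (hN0.le.trans hε.le)
  set L := Real.log ((n : ℝ) ^ 2 / ε) with hL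
  have hs1 : (1 : ℝ) ≤ Λ.card := by exact_mod_cast hΛ.card_pos
  have hlogn : 2 * Real.log n ≤ L := by
    rw [hL, Real.log_div (by positivity) hε.ne', Real.log_pow]
    have := Real.log_nonpos hε.le hε1.le
    push_cast
    linarith
  have hlogn0 : 0 ≤ Real.log n := Real.log_natCast_nonneg n
  have hL16 : 16 ≤ L := sixteen_le_log hn hlogn (by nlinarith)
  have hexp : (n : ℝ) ^ 2 = ε * Real.exp L := by
    rw [hL, Real.exp_log (by positivity)]
    field_simp
  have hsn : (Λ.card : ℝ) ≤ n / 4376 := by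
    rw [le_div_iff₀ (by norm_num)]
    nlinarith
  set σ : ZMod n × ZMod n → ℂ := fun a => x a / ‖x a‖ with hσdef
  have hσ : ∀ a, ‖σ a‖ ≤ 1 := by
    intro a
    rw [hσdef, norm_div, Complex.norm_real, norm_norm]
    exact div_self_le_one _
  -- the exponent of the power whose Frobenius norm controls the operator norm
  set r := ⌈3 * L / 2⌉₊ with hr
  have hr1 : 3 * L ≤ (2 * r : ℕ) := by
    have := Nat.le_ceil (3 * L / 2)
    push_cast
    linarith
  have hr2 : ((2 * r : ℕ) : ℝ) ≤ 5 * L := by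
    have := (Nat.ceil_lt_add_one (a := 3 * L / 2) (by positivity)).le
    push_cast
    linarith
  have hr0 : r ≠ 0 := by
    rintro h0
    rw [h0] at hr1
    norm_num at hr1
    linarith
  have hrN : (2 * r : ℕ) * ((Λ.card : ℝ) / n) ≤ 5 / 273.5 :=
    mul_div_le_of_le hn0 (Nat.cast_nonneg _) hr2 hS
  have hB1 := measureReal_iUnion_ge_le he hε Λ hσ hL hL16 hS
  have hB2 := measureReal_sum_norm_iterate_sq_ge_le he Λ r hrN
  set B1 := ⋃ m ∈ Finset.range ⌊L⌋₊, ⋃ ρ ∈ (Finset.univ : Finset (ZMod n × ZMod n)),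
      {ω | (9 / 20 : ℝ) ^ (m + 1) ≤ ‖iterate (offGram fun q => e q ω) Λ σ (m + 1) ρ‖} with hB1def
  set B2 := {ω | (9 / 20 : ℝ) ^ (2 * r) ≤ ∑ a : Λ, ∑ b : Λ,
      ‖iterate (offGram fun q => e q ω) Λ (Pi.single (b : ZMod n × ZMod n) 1) r a‖ ^ 2} with hB2def
  have hB2' : P.real B2 ≤ ε * Real.exp (-(L / 2)) := by
    refine hB2.trans ?_
    calc _ ≤ (n : ℝ) ^ 2 * Real.exp (-(3 * L / 2)) := by
          have h1 := pow_le_exp_neg (q := 26 / 45) (by norm_num) le_exp_neg_half hr1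
          have h2 : (Λ.card : ℝ) ≤ n := hsn.trans (div_le_self hn0.le (by norm_num))
          exact mul_le_mul (pow_le_pow_left₀ (Nat.cast_nonneg _) h2 2) h1 (by positivity)
            (by positivity)
      _ = _ := by
          rw [hexp, show -(3 * L / 2) = -L + -(L / 2) by ring, Real.exp_add, Real.exp_neg L]
          field_simp
  have hrem : Λ.card * (9 / 20 : ℝ) ^ ⌊L⌋₊ / (1 - 9 / 20) ≤ 1 / 10 := by
    have h1 : (9 / 20 : ℝ) ^ ⌊L⌋₊ ≤ Real.exp (-((L - 1) / 2)) :=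
      pow_le_exp_neg (by norm_num) (le_trans (by norm_num) le_exp_neg_half)
        (by linarith [Nat.lt_floor_add_one L])
    have h2 : Real.exp (-((L - 1) / 2)) ≤ 2 / n := by
      have h3 : Real.exp (-(L / 2)) ≤ 1 / n := by
        calc _ ≤ Real.exp (-Real.log n) := by gcongr; linarith
          _ = 1 / n := by rw [Real.exp_neg, Real.exp_log hn0, one_div]
      have h4 : Real.exp (1 / 2) ≤ 2 := by
        have h5 := le_exp_neg_half
        rw [Real.exp_neg, le_inv_comm₀ (by norm_num) (Real.exp_pos _)] at h5
        linarith
      calc _ = Real.exp (1 / 2) * Real.exp (-(L / 2)) := by rw [← Real.exp_add]; congr 1; ring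
        _ ≤ 2 * (1 / n) := by gcongr
        _ = _ := by ring
    calc _ ≤ (n : ℝ) / 4376 * (2 / n) / (1 - 9 / 20) := by
          have h3 := h1.trans h2
          gcongr
      _ = 2 / 4376 / (1 - 9 / 20) * ((n : ℝ) / n) := by ring
      _ ≤ 1 / 10 := by
          rw [div_self hn0.ne']
          norm_num
  have hsub : Gᶜ ⊆ {ω | ¬ ∀ q, ‖e q ω‖ = 1} ∪ (B1 ∪ B2) := by
    intro ω hω
    by_contra hcon
    simp only [Set.mem_union, not_or] at hcon
    obtain ⟨h1, h2, h3⟩ := hcon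
    have h1' : ∀ q, ‖e q ω‖ = 1 := not_not.1 h1
    refine hω (basisPursuitRecovers_of_iterate e ω h1' x hΛ hx (δ := 9 / 20) (by norm_num)
      (by norm_num) hr0 (le_of_lt (not_le.1 h3)) ⌊L⌋₊ fun ρ => ?_)
    have h4 : ∑ m ∈ Finset.range ⌊L⌋₊, ‖iterate (offGram fun q => e q ω) Λ σ (m + 1) ρ‖ ≤
        ∑ m ∈ Finset.range ⌊L⌋₊, (9 / 20 : ℝ) * (9 / 20 : ℝ) ^ m := by
      refine Finset.sum_le_sum fun m hm => ?_
      rw [← pow_succ']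
      by_contra! hlt
      exact h2 (Set.mem_biUnion hm (Set.mem_biUnion (Finset.mem_coe.2 (Finset.mem_univ ρ)) hlt.le))
    have h5 : ∑ m ∈ Finset.range ⌊L⌋₊, (9 / 20 : ℝ) * (9 / 20 : ℝ) ^ m ≤ 9 / 11 := by
      rw [← Finset.mul_sum, geom_sum_eq (by norm_num)]
      have : (0 : ℝ) ≤ (9 / 20) ^ ⌊L⌋₊ := by positivity
      norm_num
      linarith
    linarith
  calc P.real Gᶜ ≤ P.real ({ω | ¬ ∀ q, ‖e q ω‖ = 1} ∪ (B1 ∪ B2)) := measureReal_mono hsub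
    _ ≤ 0 + (P.real B1 + P.real B2) := by
        refine (measureReal_union_le _ _).trans ?_
        rw [hN0]
        gcongr
        exact measureReal_union_le _ _
    _ ≤ ε * ((L + 1) * Real.exp (-(L / 2))) := by linarith
    _ ≤ ε := mul_le_of_le_one_right hε.le (succ_mul_exp_neg_le hL16)

/-- Recovery with probability at least `1 - ε` under the explicit condition on the dimension. -/
lemma one_sub_le_measureReal_recovers_of_sparse (he : IsSteinhausSequence P e) {ε : ℝ}
    (hε : 0 < ε) (hε1 : ε < 1) {S : ℕ} {x : ZMod n × ZMod n → ℂ} (hx : IsSparse S x)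
    (hS : 273.5 * (S : ℝ) * Real.log ((n : ℝ) ^ 2 / ε) ≤ n) :
    1 - ε ≤ P.real {ω | BasisPursuitRecovers (gaborMatrix (randomWindow e ω)) x} := by
  classical
  set Λ : Finset (ZMod n × ZMod n) := Finset.univ.filter fun a => x a ≠ 0 with hΛdef
  have hmem : ∀ a, a ∈ Λ ↔ x a ≠ 0 := fun a => by simp [hΛdef]
  rcases Λ.eq_empty_or_nonempty with h0 | hne
  · have hx0 : x = 0 := by
      funext a
      by_contra ha
      have := (hmem a).2 ha
      simp [h0] at this
    have huniv : {ω | BasisPursuitRecovers (gaborMatrix (randomWindow e ω)) x} = Set.univ := by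
      refine Set.eq_univ_of_forall fun ω z _ hz => ?_
      obtain ⟨a, ha⟩ : ∃ a, z a ≠ 0 := by
        by_contra! hz0
        exact hz (by rw [hx0]; exact funext hz0)
      have h1 : l1Norm x = 0 := by simp [hx0, l1Norm]
      rw [h1]
      exact Finset.sum_pos' (fun _ _ => norm_nonneg _) ⟨a, Finset.mem_univ _, norm_pos_iff.2 ha⟩
    rw [huniv, probReal_univ]
    linarith
  · refine one_sub_le_measureReal_recovers he hε hε1 hne hmem (le_trans ?_ hS)
    have hcard : Λ.card ≤ S := by
      refine le_trans (Eq.le ?_) hx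
      rw [← Set.ncard_coe_finset]
      congr 1
      ext a
      simp [hΛdef]
    have hn1 : (1 : ℝ) ≤ n := by exact_mod_cast NeZero.pos n
    have hlog : 0 ≤ Real.log ((n : ℝ) ^ 2 / ε) := by
      refine Real.log_nonneg ((one_le_div hε).2 (hε1.le.trans ?_))
      exact one_le_pow₀ hn1
    gcongr

end Recovery

end GaborRecovery

theorem theorem2p3 :
    (∃ C : ℝ, 0 < C ∧
      ∀ (n : ℕ) [NeZero n] (S : ℕ) (ε : ℝ), 0 < ε → ε < 1 →
        (S : ℝ) ≤ C * (n : ℝ) / Real.log ((n : ℝ) / ε) →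
        ∀ x : ZMod n × ZMod n → ℂ, IsSparse S x →
        ∀ (Ω : Type*) [MeasurableSpace Ω] (P : Measure Ω) [IsProbabilityMeasure P]
          (e : ZMod n → Ω → ℂ), IsSteinhausSequence P e →
          1 - ε ≤ P.real {ω | BasisPursuitRecovers (gaborMatrix (randomWindow e ω)) x}) ∧
    (∀ (n : ℕ) [NeZero n] (S : ℕ) (ε : ℝ), 0 < ε → ε < 1 →
        max (273.5 * (S : ℝ) * Real.log ((n : ℝ) ^ 2 / ε))
          (64.1 * (S : ℝ) * (Real.log ((S : ℝ) ^ 4 / ε) + 8.35)) ≤ (n : ℝ) →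
        ∀ x : ZMod n × ZMod n → ℂ, IsSparse S x →
        ∀ (Ω : Type*) [MeasurableSpace Ω] (P : Measure Ω) [IsProbabilityMeasure P]
          (e : ZMod n → Ω → ℂ), IsSteinhausSequence P e →
          1 - ε ≤ P.real {ω | BasisPursuitRecovers (gaborMatrix (randomWindow e ω)) x}) := by
  constructor
  · refine ⟨1 / 547, by norm_num, ?_⟩
    intro n _ S ε hε hε1 hS x hx Ω _ P _ e he
    refine GaborRecovery.one_sub_le_measureReal_recovers_of_sparse he hε hε1 hx ?_
    have hn1 : (1 : ℝ) ≤ n := by exact_mod_cast NeZero.pos n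
    have hlog : 0 < Real.log ((n : ℝ) / ε) :=
      Real.log_pos ((one_lt_div hε).2 (hε1.trans_le hn1))
    rw [le_div_iff₀ hlog] at hS
    -- `n ^ 2 / ε ≤ (n / ε) ^ 2`, so the two logarithms differ by a factor of at most `2`
    have h2 : Real.log ((n : ℝ) ^ 2 / ε) ≤ 2 * Real.log ((n : ℝ) / ε) := by
      rw [show (2 : ℝ) * Real.log ((n : ℝ) / ε) = (2 : ℕ) * Real.log ((n : ℝ) / ε) by norm_num,
        ← Real.log_pow]
      refine Real.log_le_log (by positivity) ?_
      rw [div_pow]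
      gcongr
      exact pow_le_of_le_one hε.le hε1.le two_ne_zero
    calc 273.5 * (S : ℝ) * Real.log ((n : ℝ) ^ 2 / ε)
        ≤ 273.5 * (S : ℝ) * (2 * Real.log ((n : ℝ) / ε)) := by gcongr
      _ = 547 * (S * Real.log ((n : ℝ) / ε)) := by ring
      _ ≤ 547 * (1 / 547 * n) := by gcongr
      _ = n := by ring
  · intro n _ S ε hε hε1 hS x hx Ω _ P _ e he
    exact GaborRecovery.one_sub_le_measureReal_recovers_of_sparse he hε hε1 hx
      ((le_max_left _ _).trans hS)
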